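/- Let $\kappa$ be an uncountable cardinal with $\kappa^{<\kappa}=\kappa$ (in particular $\kappa$ is regular). Equip $2^\kappa$, the set of functions $\kappa\to\{0,1\}$, with the topology generated by the sets $N_p=\{\eta\in 2^\kappa\mid \eta\restriction\alpha=p\}$ for $\alpha<\kappa$ and $p\in 2^\alpha$, and $2^\kappa\times 2^\kappa$ with the product topology. Call a set Borel if it belongs to the smallest family that contains the open sets and is closed under complements and under unions and intersections of length at most $\kappa$; a function $f\colon 2^\kappa\to 2^\kappa$ is Borel if inverse images of open sets are Borel. A Borel equivalence relation on $2^\kappa$ is an equivalence relation that is a Borel subset of $2^\kappa\times 2^\kappa$. For equivalence relations $E,F$ on $2^\kappa$ write $E\le_B F$ if there is a Borel function $f\colon 2^\kappa\to 2^\kappa$ with $(\eta,\xi)\in E\iff (f(\eta),f(\xi))\in F$ for all $\eta,\xi\in 2^\kappa$, and $E<_B F$ if $E\le_B F$ and $F\not\le_B E$. Let $\mathrm{id}$ be the identity relation on $2^\kappa$ and let $(\eta,\xi)\in E_0$ if and only if $\{\alpha<\kappa\mid \eta(\alpha)\ne\xi(\alpha)\}$ is bounded in $\kappa$. Then there is a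 set $\mathcal F$ of Borel equivalence relations on $2^\kappa$ with $|\mathcal F|=2^\kappa$ such that $\mathrm{id}<_B E<_B E_0$ for every $E\in\mathcal F$, and $\mathcal F$ is linearly ordered by $\le_B$: on $\mathcal F$ the relation $\le_B$ is reflexive, transitive, antisymmetric ($E\le_B F$ and $F\le_B E$ imply $E=F$) and total. -/

import Mathlib

open Cardinal Ordinal

universe u

/-- The set of all functions from the cardinal `κ` (as an initial ordinal) to `{0, 1}`.
A type copy of the function type, so that it does not carry the product topology. -/
def GenCantor (κ : Cardinal.{u}) : Type u := κ.ord.ToType → Bool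

namespace GenCantor

/-- The basic set `N_p` of all `η : κ → 2` extending `p : α → 2`, where `α < κ`. -/
def basicOpen {κ : Cardinal.{u}} (α : κ.ord.ToType) (p : Set.Iio α → Bool) :
    Set (GenCantor κ) :=
  {η | ∀ β : Set.Iio α, η β.1 = p β}

/-- The bounded topology, generated by the sets `N_p`. -/
instance (κ : Cardinal.{u}) : TopologicalSpace (GenCantor κ) :=
  TopologicalSpace.generateFrom {N | ∃ (α : κ.ord.ToType) (p : Set.Iio α → Bool), N = basicOpen α p}

end GenCantor

/-- The Borel sets in the generalized sense: the closure of the topology under complements and under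
unions and intersections of at most `κ` sets. -/
inductive KBorel (κ : Cardinal.{u}) {X : Type u} [TopologicalSpace X] : Set X → Prop
  | of_isOpen (U : Set X) (hU : IsOpen U) : KBorel κ U
  | compl (A : Set X) (hA : KBorel κ A) : KBorel κ Aᶜ
  | sUnion (S : Set (Set X)) (hS : #S ≤ κ) (h : ∀ A ∈ S, KBorel κ A) : KBorel κ (⋃₀ S)
  | sInter (S : Set (Set X)) (hS : #S ≤ κ) (h : ∀ A ∈ S, KBorel κ A) : KBorel κ (⋂₀ S)

/-- A function on `2^κ` is Borel if inverse images of open sets are Borel. -/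
def IsKBorelFun {κ : Cardinal.{u}} (f : GenCantor κ → GenCantor κ) : Prop :=
  ∀ U : Set (GenCantor κ), IsOpen U → KBorel κ (f ⁻¹' U)

/-- `E` is a Borel equivalence relation on `2^κ`: an equivalence relation that is a Borel subset of
`2^κ × 2^κ` with the product topology. -/
def IsBorelEquivRel {κ : Cardinal.{u}} (E : GenCantor κ → GenCantor κ → Prop) : Prop :=
  Equivalence E ∧ KBorel κ {x : GenCantor κ × GenCantor κ | E x.1 x.2}

/-- Borel reducibility `E ≤_B F`. -/
def BorelReducible {κ : Cardinal.{u}} (E F : GenCantor κ → GenCantor κ → Prop) : Prop :=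
  ∃ f : GenCantor κ → GenCantor κ, IsKBorelFun f ∧ ∀ η ξ, E η ξ ↔ F (f η) (f ξ)

/-- Strict Borel reducibility: `E ≤_B F` but not `F ≤_B E`. -/
def StrictlyBorelReducible {κ : Cardinal.{u}} (E F : GenCantor κ → GenCantor κ → Prop) : Prop :=
  BorelReducible E F ∧ ¬ BorelReducible F E

/-- The identity relation on `2^κ`. -/
def idRel (κ : Cardinal.{u}) (η ξ : GenCantor κ) : Prop := η = ξ

/-- The relation `E₀` on `2^κ`: the two functions differ only on a bounded subset of `κ`. -/
def E₀ (κ : Cardinal.{u}) (η ξ : GenCantor κ) : Prop := BddAbove {α : κ.ord.ToType | η α ≠ ξ α}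

/-! Split each point of `2^κ` into two halves by a bijection `j`. For `S ⊆ κ` let `E_S` (`stepRel j
S`) relate two points when their second halves are equal and their first halves differ by a bounded
`D` that is eventually constant below every nonminimal `α ∉ S`. The relation is controlled by `S`
modulo nonstationary sets closely enough to turn inclusions into reductions.

Upwards, if `S ⊆ T`, every condition of `E_S` except boundedness is a conjunction of `κ` relations,
each read off an initial segment. `exists_code` codes their classes into the second half, so that
`E_T` on the images recovers `E_S`. The same coding with boundedness tested level by level, followed
by Fodor's lemma, gives `E_S ≤_B E₀`.

Conversely, `E_S` does not reduce to `E_T` when `S \ T` is stationary and `S` consists of points of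
countable cofinality (`not_stepRel_reducible`). A Borel reduction is continuous on a comeager set,
hence along all eventually constant modifications `D` of one suitable `x`. Let `h D` be the change
of the first half of the image. A limit argument and Fodor's lemma show that `h` of the constant `1`
is eventually `1`, so `h` of a step function with `n` jumps is eventually `n mod 2`. Jumps that
converge fast to some `α ∈ S \ T` then yield a `D` that is `E_S`-trivial, while `h D` oscillates
below `α ∉ T`.

Finally, take disjoint stationary sets of points of countable cofinality, indexed by initial
segments, and let `S` range over the unions given by the lexicographic cuts of the points of `2^κ`.
These form a chain of size `2^κ`. -/

/-- The index set of the generalized Cantor space. -/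
abbrev Idx (κ : Cardinal.{u}) : Type u := κ.ord.ToType

/-! ### Regularity, stationary sets and Fodor's lemma. -/

section Combinatorics

variable {κ : Cardinal.{u}}

/-- König's theorem gives `κ < κ ^ cof κ`, which is impossible if `cof κ < κ`. -/
theorem isRegular_of_powerlt_eq (hκ : ℵ₀ < κ) (hpow : κ ^< κ = κ) : κ.IsRegular := by
  refine ⟨hκ.le, ?_⟩
  by_contra! h
  exact absurd (lt_power_cof_ord hκ.le) (not_lt.2 ((le_powerlt κ h).trans hpow.le))

theorem exists_forall_lt_of_mk_lt (hr : κ.IsRegular) {ι : Type u} (f : ι → Idx κ) (hι : #ι < κ) :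
    ∃ β, ∀ i, f i < β := by
  by_contra! h
  have hc : IsCofinal (Set.range f) := fun β => by
    obtain ⟨i, hi⟩ := h β
    exact ⟨f i, ⟨i, rfl⟩, hi⟩
  have h1 := Order.cof_le hc
  rw [cof_toType, hr.cof_ord] at h1
  exact absurd (h1.trans mk_range_le) (not_le.2 hι)

theorem Idx.mk_Iio_lt (α : Idx κ) : #(Set.Iio α) < κ := by
  simpa using Cardinal.mk_Iio_lt α (by simp)

theorem Idx.exists_gt (hr : κ.IsRegular) (α : Idx κ) : ∃ β, α < β := by
  obtain ⟨β, hβ⟩ := exists_forall_lt_of_mk_lt hr (fun _ : PUnit.{u + 1} => α)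
    (by simpa using one_lt_aleph0.trans_le hr.aleph0_le)
  exact ⟨β, hβ ⟨⟩⟩

theorem Idx.mk_Iic_lt (hr : κ.IsRegular) (α : Idx κ) : #(Set.Iic α) < κ := by
  obtain ⟨β, hβ⟩ := Idx.exists_gt hr α
  exact (mk_le_mk_of_subset (fun _ h => lt_of_le_of_lt h hβ)).trans_lt (Idx.mk_Iio_lt β)

theorem exists_forall_lt_nat (hr : κ.IsRegular) (hκ : ℵ₀ < κ) (f : ℕ → Idx κ) :
    ∃ β, ∀ n, f n < β := by
  obtain ⟨β, hβ⟩ := exists_forall_lt_of_mk_lt hr (fun n : ULift.{u} ℕ => f n.down) (by simpa)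
  exact ⟨β, fun n => hβ ⟨n⟩⟩

theorem Idx.exists_isLeast (hr : κ.IsRegular) : ∃ o : Idx κ, ∀ i, o ≤ i := by
  have : Nonempty (Idx κ) := by
    rw [← mk_ne_zero_iff, mk_ord_toType]; exact hr.ne_zero
  obtain ⟨o, -, ho⟩ := WellFounded.has_min (wellFounded_lt (α := Idx κ)) Set.univ Set.univ_nonempty
  exact ⟨o, fun i => not_lt.1 (ho i trivial)⟩

/-- `S` contains a nonminimal point closed under each given function. For regular uncountable `κ`
this is stationarity. -/
def MeetsClosurePoints (S : Set (Idx κ)) : Prop :=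
  ∀ F : Idx κ → Idx κ, ∃ α ∈ S, (∃ β, β < α) ∧ ∀ β < α, F β < α

theorem MeetsClosurePoints.mono {S T : Set (Idx κ)} (hS : MeetsClosurePoints S) (h : S ⊆ T) :
    MeetsClosurePoints T := fun F => by
  obtain ⟨α, hα, h'⟩ := hS F
  exact ⟨α, h hα, h'⟩

theorem exists_majorant (hr : κ.IsRegular) (F : Idx κ → Idx κ) :
    ∃ F' : Idx κ → Idx κ, ∀ β γ, γ ≤ β → F γ < F' β := by
  have := fun β => exists_forall_lt_of_mk_lt hr (fun γ : Set.Iic β => F γ) (Idx.mk_Iic_lt hr β)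
  choose F' hF' using this
  exact ⟨F', fun β γ h => hF' β ⟨γ, h⟩⟩

/-- A stationary set contains a point closed under a function of finite sequences. -/
theorem MeetsClosurePoints.exists_list (hr : κ.IsRegular) (hκ : ℵ₀ < κ) {S : Set (Idx κ)}
    (hS : MeetsClosurePoints S) (F : List (Idx κ) → Idx κ) :
    ∃ α ∈ S, (∃ β, β < α) ∧ ∀ l : List (Idx κ), (∀ a ∈ l, a < α) → F l < α := by
  -- Fewer than `κ` finite sequences live below a given `β`, so one bound serves them all and
  -- closure under the unary `G` suffices.
  have hb : ∀ β : Idx κ, ∃ γ, ∀ l : List (Set.Iic β), F (l.map Subtype.val) < γ := fun β =>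
    exists_forall_lt_of_mk_lt hr _
      ((mk_list_le_max _).trans_lt (max_lt hκ (Idx.mk_Iic_lt hr β)))
  choose G hG using hb
  obtain ⟨α, hα, ⟨β₀, hβ₀⟩, hcl⟩ := hS G
  refine ⟨α, hα, ⟨β₀, hβ₀⟩, fun l hl => ?_⟩
  have : ∃ β < α, ∀ a ∈ l, a ≤ β := by
    induction l with
    | nil => exact ⟨β₀, hβ₀, by simp⟩
    | cons a l ih =>
      obtain ⟨β, h1, h2⟩ := ih fun a h => hl a (List.mem_cons_of_mem _ h)
      refine ⟨max a β, max_lt (hl a List.mem_cons_self) h1, fun b hb => ?_⟩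
      rcases List.mem_cons.1 hb with rfl | hb
      · exact le_max_left _ _
      · exact (h2 b hb).trans (le_max_right _ _)
  obtain ⟨β, hβ, hlβ⟩ := this
  have h := hG β (l.attach.map fun a => ⟨a.1, hlβ a.1 a.2⟩)
  have h2 : (l.attach.map fun a => (⟨a.1, hlβ a.1 a.2⟩ : Set.Iic β)).map Subtype.val = l := by
    simp
  rw [h2] at h
  exact h.trans (hcl β hβ)

/-- Fodor's lemma. -/
theorem MeetsClosurePoints.fodor (hr : κ.IsRegular) {S : Set (Idx κ)}
    (hS : MeetsClosurePoints S) (g : Idx κ → Idx κ)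
    (hg : ∀ α ∈ S, (∃ β, β < α) → g α < α) :
    ∃ γ, MeetsClosurePoints {α ∈ S | g α = γ} := by
  by_contra! h
  simp only [MeetsClosurePoints, not_forall] at h
  choose F hF using h
  -- Diagonal intersection: a point `α` closed under `G` is closed under `F γ` for every `γ < α`, in
  -- particular for `γ = g α`.
  have hb : ∀ β : Idx κ, ∃ δ, ∀ p : Set.Iic β × Set.Iic β, F p.1 p.2 < δ := fun β =>
    exists_forall_lt_of_mk_lt hr _ (by
      rw [mk_prod]; simp only [Cardinal.lift_id]
      exact mul_lt_of_lt hr.aleph0_le (Idx.mk_Iic_lt hr β) (Idx.mk_Iic_lt hr β))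
  choose G hG using hb
  obtain ⟨α, hα, hne, hcl⟩ := hS G
  refine hF (g α) ⟨α, ⟨hα, rfl⟩, hne, fun β hβ => ?_⟩
  exact (hG (max (g α) β) (⟨g α, Set.mem_Iic.2 (le_max_left _ _)⟩, ⟨β, Set.mem_Iic.2 (le_max_right _ _)⟩)).trans
    (hcl _ (max_lt (hg α hα hne) hβ))

theorem MeetsClosurePoints.exists_gt {S : Set (Idx κ)}
    (hS : MeetsClosurePoints S) (β : Idx κ) : ∃ α ∈ S, β < α := by
  obtain ⟨α, hα, ⟨γ, hγ⟩, h⟩ := hS fun _ => β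
  exact ⟨α, hα, h γ hγ⟩

/-- `α` has countable cofinality. -/
def CountablyApproached (α : Idx κ) : Prop :=
  ∃ c : ℕ → Idx κ, (∀ n, c n < α) ∧ ∀ β < α, ∃ n, β ≤ c n

/-- The supremum of the iterates of an increasing majorant of `F` is closed under `F`, and it has
countable cofinality by construction. -/
theorem meetsClosurePoints_countablyApproached (hr : κ.IsRegular) (hκ : ℵ₀ < κ) :
    MeetsClosurePoints {α : Idx κ | CountablyApproached α} := fun F => by
  obtain ⟨o, -⟩ := Idx.exists_isLeast hr
  obtain ⟨F', hF'⟩ := exists_majorant hr F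
  have hG : ∀ β, ∃ γ, β < γ ∧ F' β < γ := fun β => by
    obtain ⟨γ, h⟩ := Idx.exists_gt hr (max β (F' β))
    exact ⟨γ, (le_max_left _ _).trans_lt h, (le_max_right _ _).trans_lt h⟩
  choose G hG1 hG2 using hG
  let c : ℕ → Idx κ := fun n => G^[n] o
  have hc : ∀ n, c (n + 1) = G (c n) := fun n => Function.iterate_succ_apply' _ _ _
  obtain ⟨α, hα, hmin⟩ := WellFounded.has_min (wellFounded_lt (α := Idx κ)) {β | ∀ n, c n < β}
    (exists_forall_lt_nat hr hκ c)
  have hcof : ∀ β < α, ∃ n, β ≤ c n := fun β hβ => by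
    by_contra! h
    exact hmin β h hβ
  refine ⟨α, ⟨c, hα, hcof⟩, ⟨_, hα 0⟩, fun β hβ => ?_⟩
  obtain ⟨n, hn⟩ := hcof β hβ
  calc F β < F' (c n) := hF' _ _ hn
    _ < c (n + 1) := by rw [hc]; exact hG2 _
    _ < α := hα _

/-- The points of countable cofinality include `κ` pairwise disjoint stationary sets. -/
theorem exists_disjoint_meetsClosurePoints (hr : κ.IsRegular) (hκ : ℵ₀ < κ) :
    ∃ P : Idx κ → Set (Idx κ), (∀ i, MeetsClosurePoints (P i)) ∧
      (∀ i, ∀ α ∈ P i, CountablyApproached α) ∧ ∀ i j α, α ∈ P i → α ∈ P j → i = j := by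
  classical
  have hch : ∀ α : Idx κ, ∃ c : ℕ → Idx κ, CountablyApproached α →
      (∀ n, c n < α) ∧ ∀ β < α, ∃ n, β ≤ c n := fun α => by
    by_cases h : CountablyApproached α
    · obtain ⟨c, hc⟩ := h
      exact ⟨c, fun _ => hc⟩
    · exact ⟨fun _ => α, fun h' => absurd h' h⟩
  choose c hc using hch
  -- One index `n` has `c α n` unbounded on stationary sets. Otherwise the `η n` have a common bound
  -- `ζ`, and a closure point above `ζ` whose sequence exceeds `ζ` at some `n` contradicts the
  -- choice of `F n`.
  have h1 : ∃ n, ∀ η, MeetsClosurePoints {α | CountablyApproached α ∧ η ≤ c α n} := by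
    by_contra! h
    choose η hη using h
    simp only [MeetsClosurePoints, not_forall] at hη
    choose F hF using hη
    obtain ⟨ζ, hζ⟩ := exists_forall_lt_nat hr hκ η
    have hb : ∀ β, ∃ γ, ∀ n, max ζ (F n β) < γ := fun β => exists_forall_lt_nat hr hκ _
    choose G hG using hb
    obtain ⟨α, hα, ⟨γ, hγ⟩, hcl⟩ := meetsClosurePoints_countablyApproached hr hκ G
    have hζα : ζ < α := ((le_max_left _ _).trans_lt (hG γ 0)).trans (hcl γ hγ)
    obtain ⟨n, hn⟩ := (hc α hα).2 ζ hζα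
    exact hF n ⟨α, ⟨hα, (hζ n).le.trans hn⟩, ⟨γ, hγ⟩, fun β hβ =>
      ((le_max_right _ _).trans_lt (hG β n)).trans (hcl β hβ)⟩
  obtain ⟨n, hn⟩ := h1
  -- `Γ` collects the values that `c · n` takes on a stationary set. Pressing down above any `η`
  -- finds such a value at or above `η`, so `Γ` is unbounded and has size `κ`.
  let Γ : Set (Idx κ) := {γ | MeetsClosurePoints {α | CountablyApproached α ∧ c α n = γ}}
  have hΓ : κ ≤ #Γ := by
    by_contra! h
    obtain ⟨η, hη⟩ := exists_forall_lt_of_mk_lt hr (fun γ : Γ => γ.1) h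
    obtain ⟨γ, hγ⟩ := (hn η).fodor hr (fun α => c α n) fun α hα _ => (hc α hα.1).1 n
    obtain ⟨α, ⟨hα1, hα2⟩, -⟩ := hγ.exists_gt η
    have hmem : γ ∈ Γ := hγ.mono fun α hα => ⟨hα.1.1, hα.2⟩
    exact absurd (hη ⟨γ, hmem⟩) (not_lt.2 (hα1.2.trans hα2.le))
  obtain ⟨e⟩ : #(Idx κ) ≤ #Γ := (mk_ord_toType κ).le.trans hΓ
  refine ⟨fun i => {α | CountablyApproached α ∧ c α n = (e i).1}, fun i => (e i).2,
    fun i α h => h.1, fun i j α hi hj => e.injective (Subtype.ext (hi.2.symm.trans hj.2))⟩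

end Combinatorics

/-! ### The bounded topology, Baire category and Borel maps. -/

section Topology

variable {κ : Cardinal.{u}}

namespace GenCantor

/-- `x` and `y` agree below `α`. -/
def AgreeBelow (α : Idx κ) (x y : GenCantor κ) : Prop := ∀ β < α, y β = x β

theorem AgreeBelow.mono {α β : Idx κ} {x y : GenCantor κ} (h : AgreeBelow β x y) (hαβ : α ≤ β) :
    AgreeBelow α x y := fun γ hγ => h γ (hγ.trans_le hαβ)

theorem AgreeBelow.symm {α : Idx κ} {x y : GenCantor κ} (h : AgreeBelow α x y) :
    AgreeBelow α y x := fun γ hγ => (h γ hγ).symm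

theorem AgreeBelow.trans {α : Idx κ} {x y z : GenCantor κ} (h : AgreeBelow α x y)
    (h' : AgreeBelow α y z) : AgreeBelow α x z := fun γ hγ => (h' γ hγ).trans (h γ hγ)

theorem basicOpen_eq (α : Idx κ) (x : GenCantor κ) :
    basicOpen α (fun β => x β.1) = {y | AgreeBelow α x y} := by
  ext y
  exact ⟨fun h β hβ => h ⟨β, hβ⟩, fun h β => h β.1 β.2⟩

theorem isOpen_agreeBelow (α : Idx κ) (x : GenCantor κ) : IsOpen {y | AgreeBelow α x y} := by
  rw [← basicOpen_eq]
  exact TopologicalSpace.isOpen_generateFrom_of_mem ⟨α, _, rfl⟩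

theorem isOpen_iff_agreeBelow (hr : κ.IsRegular) {U : Set (GenCantor κ)} :
    IsOpen U ↔ ∀ x ∈ U, ∃ α, ∀ y, AgreeBelow α x y → y ∈ U := by
  constructor
  · intro hU
    change TopologicalSpace.GenerateOpen _ U at hU
    induction hU with
    | basic N hN =>
      obtain ⟨α, p, rfl⟩ := hN
      exact fun x hx => ⟨α, fun y hy β => (hy β.1 β.2).trans (hx β)⟩
    | univ =>
      obtain ⟨o, -⟩ := Idx.exists_isLeast hr
      exact fun _ _ => ⟨o, fun _ _ => trivial⟩
    | inter s t _ _ hs ht =>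
      intro x hx
      obtain ⟨α, hα⟩ := hs x hx.1
      obtain ⟨β, hβ⟩ := ht x hx.2
      exact ⟨max α β, fun y hy => ⟨hα y (hy.mono (le_max_left _ _)),
        hβ y (hy.mono (le_max_right _ _))⟩⟩
    | sUnion S _ ih =>
      rintro x ⟨s, hs, hx⟩
      obtain ⟨α, hα⟩ := ih s hs x hx
      exact ⟨α, fun y hy => ⟨s, hs, hα y hy⟩⟩
  · intro h
    rw [isOpen_iff_forall_mem_open]
    intro x hx
    obtain ⟨α, hα⟩ := h x hx
    exact ⟨_, fun y hy => hα y hy, isOpen_agreeBelow α x, fun _ _ => rfl⟩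

/-- Density and openness in combinatorial form. -/
theorem exists_agreeBelow_of_dense (hr : κ.IsRegular) {U : Set (GenCantor κ)} (hU : IsOpen U)
    (hd : Dense U) (α : Idx κ) (x : GenCantor κ) :
    ∃ y β, AgreeBelow α x y ∧ α ≤ β ∧ ∀ z, AgreeBelow β y z → z ∈ U := by
  obtain ⟨y, hy, hyU⟩ := hd.inter_open_nonempty _ (isOpen_agreeBelow α x) ⟨x, fun _ _ => rfl⟩
  obtain ⟨β, hβ⟩ := (isOpen_iff_agreeBelow hr).1 hU y hyU
  exact ⟨y, max α β, hy, le_max_left _ _, fun z hz => hβ z (hz.mono (le_max_right _ _))⟩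

/-- A function is continuous when each output coordinate depends only on an initial segment. -/
theorem continuous_of_locally_determined (hr : κ.IsRegular) {f : GenCantor κ → GenCantor κ}
    (h : ∀ x i, ∃ α, ∀ y, AgreeBelow α x y → f y i = f x i) : Continuous f := by
  refine ⟨fun U hU => (isOpen_iff_agreeBelow hr).2 fun x hx => ?_⟩
  obtain ⟨α, hα⟩ := (isOpen_iff_agreeBelow hr).1 hU _ hx
  choose δ hδ using h x
  obtain ⟨γ, hγ⟩ := exists_forall_lt_of_mk_lt hr (fun i : Set.Iio α => δ i) (Idx.mk_Iio_lt α)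
  exact ⟨γ, fun y hy => hα _ fun i hi => hδ i y (hy.mono (hγ ⟨i, hi⟩).le)⟩

theorem isOpen_setOf_apply_eq (hr : κ.IsRegular) (i : Idx κ) (b : Bool) :
    IsOpen {x : GenCantor κ | x i = b} := by
  refine (isOpen_iff_agreeBelow hr).2 fun x hx => ?_
  obtain ⟨α, hα⟩ := Idx.exists_gt hr i
  exact ⟨α, fun y hy => (hy i hα).trans hx⟩

/-- Initial segments of elements of the generalized Cantor space. -/
abbrev Seg (κ : Cardinal.{u}) : Type u := Σ α : Idx κ, (Set.Iio α → Bool)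

theorem mk_seg_le (hκ : ℵ₀ < κ) (hpow : κ ^< κ = κ) : #(Seg κ) ≤ κ := by
  rw [mk_sigma]
  calc (Cardinal.sum fun α : Idx κ => #(Set.Iio α → Bool)) ≤ Cardinal.sum fun _ : Idx κ => κ := by
        refine Cardinal.sum_le_sum _ _ fun α => ?_
        have h2 : #(Set.Iio α → Bool) = 2 ^ #(Set.Iio α) := by simp
        rw [h2]
        calc (2 : Cardinal) ^ #(Set.Iio α) ≤ κ ^ #(Set.Iio α) :=
              Cardinal.power_le_power_right ((natCast_lt_aleph0 (n := 2)).le.trans hκ.le)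
          _ ≤ κ ^< κ := le_powerlt κ (Idx.mk_Iio_lt α)
          _ = κ := hpow
    _ = κ := by
        rw [Cardinal.sum_const']
        simp [mul_eq_self hκ.le]

/-- `G` contains an intersection of `κ` dense open sets. -/
def Comeager (G : Set (GenCantor κ)) : Prop :=
  ∃ D : Idx κ → Set (GenCantor κ), (∀ i, IsOpen (D i) ∧ Dense (D i)) ∧ ⋂ i, D i ⊆ G

theorem Comeager.mono {G H : Set (GenCantor κ)} (hG : Comeager G) (h : G ⊆ H) : Comeager H := by
  obtain ⟨D, hD, hDG⟩ := hG
  exact ⟨D, hD, hDG.trans h⟩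

theorem comeager_of_isOpen_dense {U : Set (GenCantor κ)} (hU : IsOpen U) (hd : Dense U)
    (hr : κ.IsRegular) : Comeager U := by
  obtain ⟨o, -⟩ := Idx.exists_isLeast hr
  exact ⟨fun _ => U, fun _ => ⟨hU, hd⟩, Set.iInter_subset _ o⟩

theorem comeager_univ (hr : κ.IsRegular) : Comeager (Set.univ : Set (GenCantor κ)) :=
  comeager_of_isOpen_dense isOpen_univ dense_univ hr

theorem comeager_iInter (hκ : ℵ₀ < κ) (hr : κ.IsRegular) {ι : Type u} (hι : #ι ≤ κ)
    {G : ι → Set (GenCantor κ)} (h : ∀ i, Comeager (G i)) : Comeager (⋂ i, G i) := by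
  classical
  rcases isEmpty_or_nonempty ι with hE | hN
  · exact (comeager_univ hr).mono fun _ _ => by simp
  choose D hD hDG using h
  have hc : #(ι × Idx κ) ≤ #(Idx κ) := by
    rw [mk_prod, mk_ord_toType]
    simp only [Cardinal.lift_id]
    calc #ι * κ ≤ κ * κ := mul_le_mul_left hι κ
      _ = κ := mul_eq_self hκ.le
  obtain ⟨o, -⟩ := Idx.exists_isLeast hr
  have : Nonempty (Idx κ) := ⟨o⟩
  obtain ⟨e⟩ := hc
  refine ⟨fun k => D (Function.invFun e k).1 (Function.invFun e k).2, fun k => hD _ _, ?_⟩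
  intro x hx
  refine Set.mem_iInter.2 fun i => hDG i (Set.mem_iInter.2 fun k => ?_)
  have := Set.mem_iInter.1 hx (e (i, k))
  simp only [Function.leftInverse_invFun e.injective (i, k)] at this
  exact this

theorem Comeager.inter (hκ : ℵ₀ < κ) (hr : κ.IsRegular) {G H : Set (GenCantor κ)}
    (hG : Comeager G) (hH : Comeager H) : Comeager (G ∩ H) := by
  have := comeager_iInter hκ hr (ι := ULift.{u} Bool)
    (by simpa using (natCast_lt_aleph0 (n := 2)).le.trans hκ.le)
    (G := fun b => if b.down then G else H) (fun b => by split_ifs <;> assumption)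
  refine this.mono fun x hx => ?_
  rw [Set.mem_iInter] at hx
  exact ⟨by simpa using hx ⟨true⟩, by simpa using hx ⟨false⟩⟩

/-- The Baire category theorem for `κ` dense open sets. -/
theorem Comeager.nonempty (hr : κ.IsRegular) {G : Set (GenCantor κ)} (hG : Comeager G) :
    G.Nonempty := by
  classical
  obtain ⟨D, hD, hDG⟩ := hG
  have hstep := fun i => exists_agreeBelow_of_dense hr (hD i).1 (hD i).2
  choose Y B hY hB hYB using hstep
  -- At stage `i` the earlier approximations are merged. Any earlier stage that decides `β` will do,
  -- since the stages turn out to be coherent (`hagree`); undecided coordinates get the value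
  -- `false`.
  let glue : ∀ i : Idx κ, ((j : Idx κ) → j < i → GenCantor κ × Idx κ) → GenCantor κ :=
    fun i p β => if h : ∃ j, ∃ hj : j < i, β < (p j hj).2 then
      (p h.choose h.choose_spec.choose).1 β else false
  have hsup : ∀ i (p : (j : Idx κ) → j < i → GenCantor κ × Idx κ), ∃ δ, ∀ j hj, (p j hj).2 < δ :=
    fun i p => by
      obtain ⟨δ, hδ⟩ := exists_forall_lt_of_mk_lt hr (fun j : Set.Iio i => (p j.1 j.2).2)
        (Idx.mk_Iio_lt i)
      exact ⟨δ, fun j hj => hδ ⟨j, hj⟩⟩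
  choose sup hsup using hsup
  let F : (i : Idx κ) → ((j : Idx κ) → j < i → GenCantor κ × Idx κ) → GenCantor κ × Idx κ :=
    fun i p => (Y i (sup i p) (glue i p), B i (sup i p) (glue i p))
  let s : Idx κ → GenCantor κ × Idx κ := WellFounded.fix (wellFounded_lt (α := Idx κ)) F
  have hs : ∀ i, s i = F i fun j _ => s j := fun i =>
    WellFounded.fix_eq (wellFounded_lt (α := Idx κ)) F i
  have hlt : ∀ i j, j < i → (s j).2 < (s i).2 := fun i j hj => by
    rw [hs i]
    exact (hsup i (fun j _ => s j) j hj).trans_le (hB i _ _)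
  have hagree : ∀ i, ∀ j < i, AgreeBelow (s j).2 (s j).1 (s i).1 := by
    intro i
    induction i using WellFoundedLT.induction with
    | ind i ih =>
      intro j hj β hβ
      have h1 : (s i).1 β = glue i (fun j _ => s j) β := by
        rw [hs i]
        exact hY i _ _ β (hβ.trans (hsup i (fun j _ => s j) j hj))
      have hex : ∃ j', ∃ _ : j' < i, β < (s j').2 := ⟨j, hj, hβ⟩
      have h2 : glue i (fun j _ => s j) β = (s hex.choose).1 β := dif_pos hex
      rw [h1, h2]
      obtain ⟨hk, hkβ⟩ := hex.choose_spec
      rcases lt_trichotomy hex.choose j with h | h | h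
      · exact (ih j hj _ h β hkβ).symm
      · rw [h]
      · exact ih _ hk j h β hβ
  let x : GenCantor κ := fun β => if h : ∃ j, β < (s j).2 then (s h.choose).1 β else false
  have hx : ∀ i, AgreeBelow (s i).2 (s i).1 x := fun i β hβ => by
    have hex : ∃ j, β < (s j).2 := ⟨i, hβ⟩
    have h2 : x β = (s hex.choose).1 β := dif_pos hex
    rw [h2]
    rcases lt_trichotomy hex.choose i with h | h | h
    · exact (hagree i _ h β hex.choose_spec).symm
    · rw [h]
    · exact hagree _ i h β hβ
  refine ⟨x, hDG (Set.mem_iInter.2 fun i => ?_)⟩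
  have := hx i
  rw [hs i] at this
  exact hYB i _ _ x this

theorem dense_union_interior_compl {X : Type*} [TopologicalSpace X] (U : Set X) :
    Dense (U ∪ interior Uᶜ) := by
  rw [interior_compl]
  intro x
  by_cases hx : x ∈ closure U
  · exact closure_mono Set.subset_union_left hx
  · exact subset_closure (Or.inr hx)

/-- The Baire property of Borel sets. For complements, replace `U` by the interior of its
complement; only the nowhere dense boundary of `U` is lost. -/
theorem exists_isOpen_comeager_iff (hκ : ℵ₀ < κ) (hr : κ.IsRegular) {A : Set (GenCantor κ)}
    (hA : KBorel κ A) : ∃ U, IsOpen U ∧ Comeager {x | x ∈ A ↔ x ∈ U} := by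
  have hcompl : ∀ A : Set (GenCantor κ), (∃ U, IsOpen U ∧ Comeager {x | x ∈ A ↔ x ∈ U}) →
      ∃ U, IsOpen U ∧ Comeager {x | x ∈ Aᶜ ↔ x ∈ U} := by
    rintro A ⟨U, hU, hG⟩
    refine ⟨interior Uᶜ, isOpen_interior, (hG.inter hκ hr (comeager_of_isOpen_dense
      (hU.union isOpen_interior) (dense_union_interior_compl U) hr)).mono ?_⟩
    rintro x ⟨h1, h2⟩
    simp only [Set.mem_ofPred_eq, Set.mem_compl_iff] at h1 ⊢
    rw [h1]
    exact ⟨fun h => h2.resolve_left h, fun h => interior_subset h⟩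
  have hunion : ∀ S : Set (Set (GenCantor κ)), #S ≤ κ →
      (∀ A ∈ S, ∃ U, IsOpen U ∧ Comeager {x | x ∈ A ↔ x ∈ U}) →
      ∃ U, IsOpen U ∧ Comeager {x | x ∈ ⋃₀ S ↔ x ∈ U} := by
    intro S hS h
    choose U hU hG using h
    refine ⟨⋃ A : S, U A.1 A.2, isOpen_iUnion fun A => hU _ _,
      (comeager_iInter hκ hr hS fun A : S => hG A.1 A.2).mono fun x hx => ?_⟩
    rw [Set.mem_iInter] at hx
    simp only [Set.mem_ofPred_eq, Set.mem_sUnion, Set.mem_iUnion]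
    exact ⟨fun ⟨A, hA, hxA⟩ => ⟨⟨A, hA⟩, (hx ⟨A, hA⟩).1 hxA⟩,
      fun ⟨A, hxA⟩ => ⟨A.1, A.2, (hx A).2 hxA⟩⟩
  induction hA with
  | of_isOpen U hU => exact ⟨U, hU, (comeager_univ hr).mono fun _ _ => Iff.rfl⟩
  | compl A _ ih => exact hcompl A ih
  | sUnion S hS _ ih => exact hunion S hS ih
  | sInter S hS _ ih =>
    rw [← compl_compl (⋂₀ S), Set.compl_sInter]
    refine hcompl _ (hunion _ (mk_image_le.trans hS) ?_)
    rintro _ ⟨A, hA, rfl⟩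
    exact hcompl A (ih A hA)

/-- A Borel function is continuous on a comeager set. -/
theorem exists_comeager_continuous (hκ : ℵ₀ < κ) (hr : κ.IsRegular)
    {f : GenCantor κ → GenCantor κ} (hf : IsKBorelFun f) :
    ∃ G, Comeager G ∧ ∀ x ∈ G, ∀ i, ∃ δ, ∀ y ∈ G, AgreeBelow δ x y → f y i = f x i := by
  have h := fun i => exists_isOpen_comeager_iff hκ hr
    (hf {x | x i = true} (isOpen_setOf_apply_eq hr i true))
  choose U hU hG using h
  -- Off the boundary of `U i`, membership in `U i` is locally constant.
  have hV : ∀ i, Comeager ({x | x ∈ f ⁻¹' {x | x i = true} ↔ x ∈ U i} ∩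
      (U i ∪ interior (U i)ᶜ)) := fun i =>
    (hG i).inter hκ hr (comeager_of_isOpen_dense ((hU i).union isOpen_interior)
      (dense_union_interior_compl _) hr)
  refine ⟨_, comeager_iInter hκ hr (mk_ord_toType κ).le hV, fun x hx i => ?_⟩
  have hxi := Set.mem_iInter.1 hx i
  have key : ∃ δ, ∀ y, AgreeBelow δ x y → (y ∈ U i ↔ x ∈ U i) := by
    rcases hxi.2 with h | h
    · obtain ⟨δ, hδ⟩ := (isOpen_iff_agreeBelow hr).1 (hU i) x h
      exact ⟨δ, fun y hy => ⟨fun _ => h, fun _ => hδ y hy⟩⟩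
    · obtain ⟨δ, hδ⟩ := (isOpen_iff_agreeBelow hr).1 isOpen_interior x h
      exact ⟨δ, fun y hy => ⟨fun h' => absurd h' (interior_subset (hδ y hy)),
        fun h' => absurd h' (interior_subset h)⟩⟩
  obtain ⟨δ, hδ⟩ := key
  refine ⟨δ, fun y hy hxy => ?_⟩
  have hyi := Set.mem_iInter.1 hy i
  have : f y i = true ↔ f x i = true := hyi.1.trans ((hδ y hxy).trans hxi.1.symm)
  exact Bool.eq_iff_iff.2 this

end GenCantor

theorem KBorel.iUnion {X : Type u} [TopologicalSpace X] {ι : Type u} (hι : #ι ≤ κ)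
    {A : ι → Set X} (h : ∀ i, KBorel κ (A i)) : KBorel κ (⋃ i, A i) := by
  rw [← Set.sUnion_range]
  refine KBorel.sUnion _ (mk_range_le.trans hι) ?_
  rintro _ ⟨i, rfl⟩
  exact h i

theorem KBorel.iInter {X : Type u} [TopologicalSpace X] {ι : Type u} (hι : #ι ≤ κ)
    {A : ι → Set X} (h : ∀ i, KBorel κ (A i)) : KBorel κ (⋂ i, A i) := by
  rw [← Set.sInter_range]
  refine KBorel.sInter _ (mk_range_le.trans hι) ?_
  rintro _ ⟨i, rfl⟩
  exact h i

theorem IsKBorelFun.preimage {f : GenCantor κ → GenCantor κ} (hf : IsKBorelFun f)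
    {A : Set (GenCantor κ)} (hA : KBorel κ A) : KBorel κ (f ⁻¹' A) := by
  induction hA with
  | of_isOpen U hU => exact hf U hU
  | compl A _ ih => exact KBorel.compl _ ih
  | sUnion S hS _ ih =>
    rw [Set.sUnion_eq_iUnion, Set.preimage_iUnion]
    exact KBorel.iUnion hS fun A => ih A.1 A.2
  | sInter S hS _ ih =>
    rw [Set.sInter_eq_iInter, Set.preimage_iInter]
    exact KBorel.iInter hS fun A => ih A.1 A.2

theorem isKBorelFun_of_continuous {f : GenCantor κ → GenCantor κ} (hf : Continuous f) :
    IsKBorelFun f := fun _ hU => KBorel.of_isOpen _ (hU.preimage hf)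

theorem BorelReducible.refl (E : GenCantor κ → GenCantor κ → Prop) : BorelReducible E E :=
  ⟨id, isKBorelFun_of_continuous continuous_id, fun _ _ => Iff.rfl⟩

theorem BorelReducible.trans {E F H : GenCantor κ → GenCantor κ → Prop}
    (h : BorelReducible E F) (h' : BorelReducible F H) : BorelReducible E H := by
  obtain ⟨f, hf, hfE⟩ := h
  obtain ⟨g, hg, hgF⟩ := h'
  exact ⟨g ∘ f, fun U hU => hf.preimage (hg U hU), fun η ξ => (hfE η ξ).trans (hgF _ _)⟩

end Topology

/-! ### Coding locally determined relations, and the relations `E_S`. -/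

section Relations

variable {κ : Cardinal.{u}}

namespace GenCantor

/-- Code the classes of `x` with respect to `κ` many equivalence relations, each of which is
determined by an initial segment. -/
theorem exists_code (hκ : ℵ₀ < κ) (hpow : κ ^< κ = κ) (R : Idx κ → Setoid (GenCantor κ))
    (hR : ∀ α, ∃ δ, ∀ x y, AgreeBelow δ x y → (R α).r x y) :
    ∃ c : GenCantor κ → GenCantor κ,
      (∀ x i, ∃ δ, ∀ y, AgreeBelow δ x y → c y i = c x i) ∧
      (∀ x y, c x = c y ↔ ∀ α, (R α).r x y) ∧
      ∀ x y, E₀ κ (c x) (c y) ↔ ∃ α₀, ∀ α, α₀ ≤ α → (R α).r x y := by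
  classical
  have hr := isRegular_of_powerlt_eq hκ hpow
  choose δ hδ using hR
  -- A class of `R α` is determined by a representative's segment of length `δ α`, so there are at
  -- most `κ` classes over all levels.
  have hcard : #(Σ α, Quotient (R α)) ≤ #(Idx κ) := by
    have h1 : #(Σ α, Quotient (R α)) ≤ #(Idx κ × Seg κ) := by
      refine mk_le_of_injective (f := fun p => (p.1, ⟨δ p.1, fun β => p.2.out β.1⟩)) ?_
      rintro ⟨α, q⟩ ⟨α', q'⟩ h
      simp only [Prod.mk.injEq] at h
      obtain ⟨rfl, h⟩ := h
      simp only [Sigma.mk.injEq, heq_eq_eq, true_and] at h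
      have h2 : (R α).r q.out q'.out := hδ α _ _ fun β hβ => (congrFun h ⟨β, hβ⟩).symm
      have : q = q' := by
        rw [← Quotient.out_eq q, ← Quotient.out_eq q']
        exact Quotient.sound h2
      rw [this]
    refine h1.trans ?_
    rw [mk_prod, mk_ord_toType]
    simp only [Cardinal.lift_id]
    calc κ * #(Seg κ) ≤ κ * κ := mul_le_mul_right (mk_seg_le hκ hpow) κ
      _ = κ := mul_eq_self hκ.le
  obtain ⟨e⟩ := hcard
  -- `c x` is the characteristic function of the set of codes of the classes of `x`.
  let c : GenCantor κ → GenCantor κ := fun x i =>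
    decide (∃ α, i = e ⟨α, Quotient.mk (R α) x⟩)
  have hc : ∀ x α q, c x (e ⟨α, q⟩) = true ↔ Quotient.mk (R α) x = q := fun x α q => by
    simp only [c, decide_eq_true_eq]
    constructor
    · rintro ⟨β, h⟩
      have := e.injective h
      simp only [Sigma.mk.injEq] at this
      obtain ⟨rfl, h'⟩ := this
      exact (eq_of_heq h').symm
    · rintro rfl
      exact ⟨α, rfl⟩
  have hc0 : ∀ x i, (¬ ∃ p, i = e p) → c x i = false := fun x i h => by
    simp only [c, decide_eq_false_iff_not]
    rintro ⟨α, hα⟩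
    exact h ⟨_, hα⟩
  have hcR : ∀ x y α q, (R α).r x y → c x (e ⟨α, q⟩) = c y (e ⟨α, q⟩) := fun x y α q h => by
    have h' : Quotient.mk (R α) x = Quotient.mk (R α) y := Quotient.sound h
    rw [Bool.eq_iff_iff, hc, hc, h']
  have hcR' : ∀ x y α, c x (e ⟨α, Quotient.mk (R α) x⟩) = c y (e ⟨α, Quotient.mk (R α) x⟩) →
      (R α).r x y := fun x y α h => by
    rw [(hc x α _).2 rfl] at h
    exact (R α).symm (Quotient.exact ((hc y α _).1 h.symm))
  refine ⟨c, fun x i => ?_, fun x y => ⟨fun h α => ?_, fun h => ?_⟩,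
    fun x y => ⟨fun ⟨b, hb⟩ => ?_, fun ⟨α₀, hα₀⟩ => ?_⟩⟩
  · by_cases h : ∃ p, i = e p
    · obtain ⟨⟨α, q⟩, rfl⟩ := h
      exact ⟨δ α, fun y hy => (hcR x y α q (hδ α x y hy)).symm⟩
    · exact ⟨i, fun y _ => (hc0 y i h).trans (hc0 x i h).symm⟩
  · exact hcR' x y α (by rw [h])
  · funext i
    by_cases hi : ∃ p, i = e p
    · obtain ⟨⟨α, q⟩, rfl⟩ := hi
      exact hcR x y α q (h α)
    · rw [hc0 x i hi, hc0 y i hi]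
  -- Each level where `x` and `y` are inequivalent contributes its own differing coordinate below
  -- the bound `b`, so there are fewer than `κ` such levels.
  · have hcard : #{α | ¬ (R α).r x y} < κ := by
      refine lt_of_le_of_lt ?_ (Idx.mk_Iic_lt hr b)
      refine mk_le_of_injective (f := fun α => ⟨e ⟨α.1, Quotient.mk (R α.1) x⟩,
        hb fun h => α.2 (hcR' x y α.1 h)⟩) ?_
      rintro ⟨α, hα⟩ ⟨β, hβ⟩ h
      have := congrArg Sigma.fst (e.injective (congrArg Subtype.val h))
      exact Subtype.ext this
    obtain ⟨α₀, h₀⟩ := exists_forall_lt_of_mk_lt hr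
      (fun α : {α | ¬ (R α).r x y} => α.1) hcard
    refine ⟨α₀, fun α hα => ?_⟩
    by_contra h
    exact absurd (h₀ ⟨α, h⟩) (not_lt.2 hα)
  -- A level can produce a difference only at the codes of the classes of `x` and of `y`, so the
  -- levels below `α₀` give fewer than `κ` coordinates.
  · obtain ⟨b, hb⟩ := exists_forall_lt_of_mk_lt hr
      (fun p : Set.Iio α₀ × ULift.{u} Bool => e ⟨p.1.1, if p.2.down then Quotient.mk _ x
        else Quotient.mk _ y⟩) (by
        rw [mk_prod]
        simp only [Cardinal.lift_id]
        exact mul_lt_of_lt hr.aleph0_le (Idx.mk_Iio_lt α₀)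
          (lt_trans (by simp) hκ))
    refine ⟨b, fun i hi => ?_⟩
    by_cases hp : ∃ p, i = e p
    · obtain ⟨⟨α, q⟩, rfl⟩ := hp
      have hα : α < α₀ := by
        by_contra h
        exact hi (hcR x y α q (hα₀ α (not_lt.1 h)))
      have : Quotient.mk (R α) x = q ∨ Quotient.mk (R α) y = q := by
        rw [← hc, ← hc]
        by_contra! h
        simp only [ne_eq, Bool.not_eq_true] at h
        exact hi (h.1.trans h.2.symm)
      rcases this with rfl | rfl
      · simpa using (hb (⟨α, hα⟩, ⟨true⟩)).le
      · simpa using (hb (⟨α, hα⟩, ⟨false⟩)).le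
    · exact absurd ((hc0 x i hp).trans (hc0 y i hp).symm) hi

/-- `D` is eventually constant below `α`. -/
def EvConstBelow (D : Idx κ → Bool) (α : Idx κ) : Prop :=
  ∃ β < α, ∃ b, ∀ γ, β ≤ γ → γ < α → D γ = b

theorem EvConstBelow.congr {D D' : Idx κ → Bool} {α : Idx κ} (h : EvConstBelow D α)
    (hD : ∀ γ < α, D' γ = D γ) : EvConstBelow D' α := by
  obtain ⟨β, hβ, b, hb⟩ := h
  exact ⟨β, hβ, b, fun γ h1 h2 => (hD γ h2).trans (hb γ h1 h2)⟩

theorem EvConstBelow.xor {D D' : Idx κ → Bool} {α : Idx κ} (h : EvConstBelow D α)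
    (h' : EvConstBelow D' α) : EvConstBelow (fun i => D i ^^ D' i) α := by
  obtain ⟨β, hβ, b, hb⟩ := h
  obtain ⟨β', hβ', b', hb'⟩ := h'
  exact ⟨max β β', max_lt hβ hβ', b ^^ b', fun γ h1 h2 => by
    beta_reduce
    rw [hb γ ((le_max_left _ _).trans h1) h2, hb' γ ((le_max_right _ _).trans h1) h2]⟩

/-- The jumps of `D` accumulate only at points of `S`. -/
def JumpsAccumulateIn (S : Set (Idx κ)) (D : Idx κ → Bool) : Prop :=
  ∀ α ∉ S, (∃ β, β < α) → EvConstBelow D α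

variable (j : Idx κ ⊕ Idx κ ≃ Idx κ)

/-- The first half of `x`. -/
def fstHalf (x : GenCantor κ) : GenCantor κ := fun i => x (j (Sum.inl i))

/-- The second half of `x`. -/
def sndHalf (x : GenCantor κ) : GenCantor κ := fun i => x (j (Sum.inr i))

/-- The element with the given halves. -/
def join (x y : GenCantor κ) : GenCantor κ := fun i => Sum.elim x y (j.symm i)

theorem join_inl (x y : GenCantor κ) (i : Idx κ) : join j x y (j (Sum.inl i)) = x i := by
  change Sum.elim x y (j.symm (j _)) = _
  rw [j.symm_apply_apply]; rfl

theorem join_inr (x y : GenCantor κ) (i : Idx κ) : join j x y (j (Sum.inr i)) = y i := by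
  change Sum.elim x y (j.symm (j _)) = _
  rw [j.symm_apply_apply]; rfl

theorem fstHalf_join (x y : GenCantor κ) : fstHalf j (join j x y) = x :=
  funext fun i => join_inl j x y i

theorem sndHalf_join (x y : GenCantor κ) : sndHalf j (join j x y) = y :=
  funext fun i => join_inr j x y i

theorem join_halves (x : GenCantor κ) : join j (fstHalf j x) (sndHalf j x) = x := by
  funext i
  obtain ⟨k, rfl⟩ := j.surjective i
  cases k
  · exact join_inl _ _ _ _
  · exact join_inr _ _ _ _

/-- The constant function. -/
def const (b : Bool) : GenCantor κ := fun _ => b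

/-- Pointwise exclusive or. -/
def diff (x y : GenCantor κ) : GenCantor κ := fun i => x i ^^ y i

@[simp] theorem diff_apply (x y : GenCantor κ) (i : Idx κ) : diff x y i = (x i ^^ y i) := rfl

theorem diff_comm (x y : GenCantor κ) : diff x y = diff y x := by
  funext i; simp [Bool.xor_comm]

theorem diff_diff_cancel (x y z : GenCantor κ) : diff (diff x y) (diff y z) = diff x z := by
  funext i; simp only [diff_apply]; cases x i <;> cases y i <;> cases z i <;> rfl

/-- The relation of the chain: equal second halves, and first halves that differ on a bounded set
the jumps of which accumulate only at points of `S`. -/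
def stepRel (S : Set (Idx κ)) (x y : GenCantor κ) : Prop :=
  (∃ β, ∀ γ, β ≤ γ → diff (fstHalf j x) (fstHalf j y) γ = false) ∧
    JumpsAccumulateIn S (diff (fstHalf j x) (fstHalf j y)) ∧ sndHalf j x = sndHalf j y

theorem evConstBelow_diff_self (x : GenCantor κ) {α : Idx κ} (hα : ∃ β, β < α) :
    EvConstBelow (diff x x) α := by
  obtain ⟨β, hβ⟩ := hα
  exact ⟨β, hβ, false, fun _ _ _ => by simp⟩

theorem EvConstBelow.diff_trans {x y z : GenCantor κ} {α : Idx κ}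
    (h : EvConstBelow (diff x y) α) (h' : EvConstBelow (diff y z) α) :
    EvConstBelow (diff x z) α := by
  rw [← diff_diff_cancel x y z]; exact h.xor h'

theorem stepRel_equivalence (hr : κ.IsRegular) (S : Set (Idx κ)) : Equivalence (stepRel j S) := by
  refine ⟨fun x => ?_, fun {x y} h => ?_, fun {x y z} h h' => ?_⟩
  · obtain ⟨o, -⟩ := Idx.exists_isLeast hr
    exact ⟨⟨o, fun _ _ => by simp⟩, fun α _ hα => evConstBelow_diff_self _ hα, rfl⟩
  · unfold stepRel
    rw [diff_comm]
    exact ⟨h.1, h.2.1, h.2.2.symm⟩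
  · obtain ⟨⟨β, hβ⟩, h2, h3⟩ := h
    obtain ⟨⟨β', hβ'⟩, h2', h3'⟩ := h'
    refine ⟨⟨max β β', fun γ hγ => ?_⟩, fun α hα hne => (h2 α hα hne).diff_trans (h2' α hα hne),
      h3.trans h3'⟩
    rw [← diff_diff_cancel _ (fstHalf j y), diff_apply, hβ γ ((le_max_left _ _).trans hγ),
      hβ' γ ((le_max_right _ _).trans hγ)]
    rfl

theorem xor_eq_false_iff (a b : Bool) : (a ^^ b) = false ↔ a = b := by
  cases a <;> cases b <;> simp

theorem stepRel_borel (hκ : ℵ₀ < κ) (hr : κ.IsRegular) (S : Set (Idx κ)) :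
    KBorel κ {x : GenCantor κ × GenCantor κ | stepRel j S x.1 x.2} := by
  have hK : #(Idx κ) ≤ κ := (mk_ord_toType κ).le
  have hb : #(ULift.{u} Bool) ≤ κ := by simpa using (natCast_lt_aleph0 (n := 2)).le.trans hκ.le
  have hclopen : ∀ i i' b b', IsOpen {x : GenCantor κ × GenCantor κ | x.1 i = b ∧ x.2 i' = b'} :=
    fun i i' b b' => ((isOpen_setOf_apply_eq hr i b).preimage continuous_fst).inter
      ((isOpen_setOf_apply_eq hr i' b').preimage continuous_snd)
  have hxor : ∀ i i' b, KBorel κ {x : GenCantor κ × GenCantor κ | (x.1 i ^^ x.2 i') = b} := by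
    intro i i' b
    refine KBorel.of_isOpen _ ?_
    have : {x : GenCantor κ × GenCantor κ | (x.1 i ^^ x.2 i') = b} =
        ⋃ p : Bool, {x | x.1 i = p ∧ x.2 i' = (p ^^ b)} := by
      ext x
      simp only [Set.mem_ofPred_eq, Set.mem_iUnion]
      cases x.1 i <;> cases x.2 i' <;> cases b <;> simp
    rw [this]
    exact isOpen_iUnion fun p => hclopen _ _ _ _
  have h1 : {x : GenCantor κ × GenCantor κ | stepRel j S x.1 x.2} =
      (⋃ β : Idx κ, ⋂ γ : Set.Ici β,
        {x | (x.1 (j (Sum.inl γ.1)) ^^ x.2 (j (Sum.inl γ.1))) = false}) ∩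
      ((⋂ α : {α : Idx κ | α ∉ S ∧ ∃ β, β < α}, ⋃ β : Set.Iio α.1, ⋃ b : ULift.{u} Bool,
        ⋂ γ : {γ : Idx κ | β.1 ≤ γ ∧ γ < α.1},
          {x | (x.1 (j (Sum.inl γ.1)) ^^ x.2 (j (Sum.inl γ.1))) = b.down}) ∩
      ⋂ i : Idx κ, {x | (x.1 (j (Sum.inr i)) ^^ x.2 (j (Sum.inr i))) = false}) := by
    ext x
    have hsnd : sndHalf j x.1 = sndHalf j x.2 ↔
        ∀ i, (x.1 (j (Sum.inr i)) ^^ x.2 (j (Sum.inr i))) = false :=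
      funext_iff.trans (forall_congr' fun i => (xor_eq_false_iff _ _).symm)
    simp only [stepRel, hsnd, JumpsAccumulateIn, EvConstBelow, diff_apply, fstHalf,
      Set.mem_ofPred_eq, Set.mem_inter_iff, Set.mem_iUnion, Set.mem_iInter, Subtype.forall,
      Subtype.exists, Set.mem_Ici, Set.mem_Iio, ULift.exists, exists_prop, and_imp, Idx]
  have hsub : ∀ s : Set (Idx κ), #s ≤ κ := fun s => (mk_set_le s).trans hK
  have hinter : ∀ A B : Set (GenCantor κ × GenCantor κ), KBorel κ A → KBorel κ B →
      KBorel κ (A ∩ B) := fun A B hA hB => by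
    rw [Set.inter_eq_iInter]
    have : (⋂ b : Bool, bif b then A else B) = ⋂ b : ULift.{u} Bool, bif b.down then A else B := by
      ext; simp [Set.mem_iInter, ULift.forall]
    rw [this]
    exact KBorel.iInter hb fun ⟨b⟩ => by cases b <;> assumption
  rw [h1]
  refine hinter _ _ (KBorel.iUnion hK fun β => KBorel.iInter (hsub _) fun γ => hxor _ _ _)
    (hinter _ _ (KBorel.iInter (hsub _) fun α => KBorel.iUnion (hsub _) fun β =>
      KBorel.iUnion hb fun b => KBorel.iInter (hsub _) fun γ => hxor _ _ _)
      (KBorel.iInter hK fun i => hxor _ _ _))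

theorem isBorelEquivRel_stepRel (hκ : ℵ₀ < κ) (hr : κ.IsRegular) (S : Set (Idx κ)) :
    IsBorelEquivRel (stepRel j S) :=
  ⟨stepRel_equivalence j hr S, stepRel_borel j hκ hr S⟩

/-- An initial segment of `x` determines an initial segment of its halves. -/
theorem exists_agreeBelow_halves (hr : κ.IsRegular) (α : Idx κ) : ∃ δ, ∀ x y : GenCantor κ,
    AgreeBelow δ x y → AgreeBelow α (fstHalf j x) (fstHalf j y) ∧
      AgreeBelow α (sndHalf j x) (sndHalf j y) := by
  obtain ⟨δ, hδ⟩ := exists_forall_lt_of_mk_lt hr (fun i : Set.Iio α => j (Sum.inl i.1))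
    (Idx.mk_Iio_lt α)
  obtain ⟨δ', hδ'⟩ := exists_forall_lt_of_mk_lt hr (fun i : Set.Iio α => j (Sum.inr i.1))
    (Idx.mk_Iio_lt α)
  exact ⟨max δ δ', fun x y h =>
    ⟨fun i hi => h _ ((hδ ⟨i, hi⟩).trans_le (le_max_left _ _)),
      fun i hi => h _ ((hδ' ⟨i, hi⟩).trans_le (le_max_right _ _))⟩⟩

theorem AgreeBelow.evConstBelow_diff {α γ : Idx κ} {x y : GenCantor κ} (h : AgreeBelow α x y)
    (hγ : γ ≤ α) (hne : ∃ β, β < γ) : EvConstBelow (diff x y) γ := by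
  obtain ⟨β, hβ⟩ := hne
  exact ⟨β, hβ, false, fun δ _ h2 => by simp [h δ (h2.trans_le hγ)]⟩

/-- Approximations of `stepRel j S` at level `α`. -/
def levelSetoid (S : Set (Idx κ)) (α : Idx κ) : Setoid (GenCantor κ) where
  r x y := (∀ γ ≤ α, γ ∉ S → (∃ β, β < γ) → EvConstBelow (diff (fstHalf j x) (fstHalf j y)) γ) ∧
    AgreeBelow α (sndHalf j x) (sndHalf j y)
  iseqv := by
    refine ⟨fun x => ⟨fun γ _ _ hne => evConstBelow_diff_self _ hne, fun _ _ => rfl⟩,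
      fun {x y} h => ⟨?_, h.2.symm⟩, fun {x y z} h h' =>
        ⟨fun γ h1 h2 h3 => (h.1 γ h1 h2 h3).diff_trans (h'.1 γ h1 h2 h3), h.2.trans h'.2⟩⟩
    rw [diff_comm]
    exact h.1

theorem levelSetoid_of_agreeBelow (S : Set (Idx κ)) {α : Idx κ} {x y : GenCantor κ}
    (h : AgreeBelow α (fstHalf j x) (fstHalf j y)) (h' : AgreeBelow α (sndHalf j x) (sndHalf j y)) :
    (levelSetoid j S α).r x y :=
  ⟨fun _ h1 _ h3 => h.evConstBelow_diff h1 h3, h'⟩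

theorem stepRel_iff_forall_level (hr : κ.IsRegular) (S : Set (Idx κ)) (x y : GenCantor κ) :
    (JumpsAccumulateIn S (diff (fstHalf j x) (fstHalf j y)) ∧ sndHalf j x = sndHalf j y) ↔
      ∀ α, (levelSetoid j S α).r x y := by
  constructor
  · rintro ⟨h1, h2⟩ α
    exact ⟨fun γ _ => h1 γ, fun β _ => by rw [h2]⟩
  · intro h
    refine ⟨fun α => (h α).1 α le_rfl, funext fun i => ?_⟩
    obtain ⟨β, hβ⟩ := Idx.exists_gt hr i
    exact ((h β).2 i hβ).symm

/-- Enlarging `S` goes up in the order of reducibility. -/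
theorem stepRel_reducible_of_subset (hκ : ℵ₀ < κ) (hpow : κ ^< κ = κ) {S T : Set (Idx κ)}
    (hST : S ⊆ T) : BorelReducible (stepRel j S) (stepRel j T) := by
  have hr := isRegular_of_powerlt_eq hκ hpow
  obtain ⟨c, hc, hceq, -⟩ := exists_code hκ hpow (levelSetoid j S) fun α => by
    obtain ⟨δ, hδ⟩ := exists_agreeBelow_halves j hr α
    exact ⟨δ, fun x y h => levelSetoid_of_agreeBelow j S (hδ x y h).1 (hδ x y h).2⟩
  -- Keeping the first half preserves boundedness; equality of the codes imposes the remaining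
  -- conditions of `E_S`, which imply those for `T`.
  refine ⟨fun x => join j (fstHalf j x) (c x), isKBorelFun_of_continuous
    (continuous_of_locally_determined hr fun x i => ?_), fun x y => ?_⟩
  · obtain ⟨k, rfl⟩ := j.surjective i
    rcases k with k | k
    · obtain ⟨δ, hδ⟩ := Idx.exists_gt hr (j (Sum.inl k))
      exact ⟨δ, fun y hy => by rw [join_inl, join_inl]; exact hy _ hδ⟩
    · obtain ⟨δ, hδ⟩ := hc x k
      exact ⟨δ, fun y hy => by rw [join_inr, join_inr]; exact hδ y hy⟩
  · unfold stepRel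
    rw [fstHalf_join, fstHalf_join, sndHalf_join, sndHalf_join, hceq,
      ← stepRel_iff_forall_level j hr]
    exact ⟨fun ⟨h1, h2, h3⟩ => ⟨h1, fun α hα => h2 α fun h => hα (hST h), h2, h3⟩,
      fun ⟨h1, _, h2, h3⟩ => ⟨h1, h2, h3⟩⟩

theorem idRel_reducible_stepRel (hr : κ.IsRegular) (S : Set (Idx κ)) :
    BorelReducible (idRel κ) (stepRel j S) := by
  refine ⟨fun x => join j (const false) x, isKBorelFun_of_continuous
    (continuous_of_locally_determined hr fun x i => ?_), fun x y => ?_⟩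
  · obtain ⟨k, rfl⟩ := j.surjective i
    rcases k with k | k
    · exact ⟨j (Sum.inl k), fun y _ => by rw [join_inl, join_inl]⟩
    · obtain ⟨δ, hδ⟩ := Idx.exists_gt hr k
      exact ⟨δ, fun y hy => by rw [join_inr, join_inr]; exact hy _ hδ⟩
  · constructor
    · intro h
      obtain rfl : x = y := h
      exact (stepRel_equivalence j hr S).refl _
    · intro h
      have h' := h.2.2
      beta_reduce at h'
      rwa [sndHalf_join, sndHalf_join] at h'

/-- Approximations of `stepRel j S` at level `α`, with bounded differences. -/
def boundedLevelSetoid (S : Set (Idx κ)) (α : Idx κ) : Setoid (GenCantor κ) where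
  r x y := (levelSetoid j S α).r x y ∧
    ((∃ β, β < α) → ∃ β < α, ∀ γ, β ≤ γ → γ < α → fstHalf j x γ = fstHalf j y γ)
  iseqv := by
    refine ⟨fun x => ⟨(levelSetoid j S α).refl x, fun ⟨β, hβ⟩ => ⟨β, hβ, fun _ _ _ => rfl⟩⟩,
      fun {x y} h => ⟨(levelSetoid j S α).symm h.1, fun hne => ?_⟩,
      fun {x y z} h h' => ⟨(levelSetoid j S α).trans h.1 h'.1, fun hne => ?_⟩⟩
    · obtain ⟨β, hβ, h2⟩ := h.2 hne
      exact ⟨β, hβ, fun γ h3 h4 => (h2 γ h3 h4).symm⟩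
    · obtain ⟨β, hβ, h2⟩ := h.2 hne
      obtain ⟨β', hβ', h2'⟩ := h'.2 hne
      exact ⟨max β β', max_lt hβ hβ', fun γ h3 h4 =>
        (h2 γ ((le_max_left _ _).trans h3) h4).trans (h2' γ ((le_max_right _ _).trans h3) h4)⟩

/-- A property of indices that holds on a final segment below each point of a stationary set holds
on a final segment. -/
theorem exists_forall_ge_of_meetsClosurePoints (hr : κ.IsRegular) {S : Set (Idx κ)}
    (hS : MeetsClosurePoints S) {p : Idx κ → Prop}
    (h : ∀ α ∈ S, (∃ β, β < α) → ∃ β < α, ∀ γ, β ≤ γ → γ < α → p γ) :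
    ∃ β, ∀ γ, β ≤ γ → p γ := by
  classical
  have hg : ∀ α, ∃ β, α ∈ S → (∃ β, β < α) → β < α ∧ ∀ γ, β ≤ γ → γ < α → p γ := fun α => by
    by_cases h' : α ∈ S ∧ ∃ β, β < α
    · obtain ⟨β, hβ⟩ := h α h'.1 h'.2
      exact ⟨β, fun _ _ => hβ⟩
    · exact ⟨α, fun h1 h2 => absurd ⟨h1, h2⟩ h'⟩
  choose g hg using hg
  obtain ⟨β, hβ⟩ := hS.fodor hr g fun α hα hne => (hg α hα hne).1
  refine ⟨β, fun γ hγ => ?_⟩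
  obtain ⟨α, ⟨hα1, hα2⟩, hα3⟩ := hβ.exists_gt γ
  exact (hg α hα1 ⟨γ, hα3⟩).2 γ (hα2.trans_le hγ) hα3

theorem meetsClosurePoints_Ioi (hr : κ.IsRegular) (hκ : ℵ₀ < κ) (α : Idx κ) :
    MeetsClosurePoints (Set.Ioi α) := fun F => by
  obtain ⟨β, hβ, hne, h⟩ := meetsClosurePoints_countablyApproached hr hκ fun γ => max α (F γ)
  obtain ⟨γ, hγ⟩ := hne
  exact ⟨β, (le_max_left _ _).trans_lt (h γ hγ), ⟨γ, hγ⟩,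
    fun δ hδ => (le_max_right _ _).trans_lt (h δ hδ)⟩

/-- Boundedness is not determined by initial segments, but boundedness below `α` is. If it holds
below all `α` from some point on, Fodor's lemma yields a single bound. -/
theorem stepRel_reducible_E₀ (hκ : ℵ₀ < κ) (hpow : κ ^< κ = κ) (S : Set (Idx κ)) :
    BorelReducible (stepRel j S) (E₀ κ) := by
  have hr := isRegular_of_powerlt_eq hκ hpow
  obtain ⟨c, hc, -, hcE⟩ := exists_code hκ hpow (boundedLevelSetoid j S) fun α => by
    obtain ⟨δ, hδ⟩ := exists_agreeBelow_halves j hr α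
    exact ⟨δ, fun x y h => ⟨levelSetoid_of_agreeBelow j S (hδ x y h).1 (hδ x y h).2,
      fun ⟨β, hβ⟩ => ⟨β, hβ, fun γ _ h2 => ((hδ x y h).1 γ h2).symm⟩⟩⟩
  refine ⟨c, isKBorelFun_of_continuous (continuous_of_locally_determined hr hc), fun x y => ?_⟩
  rw [hcE]
  constructor
  · rintro ⟨⟨β, hβ⟩, h2⟩
    obtain ⟨α₀, hα₀⟩ := Idx.exists_gt hr β
    refine ⟨α₀, fun α hα => ⟨(stepRel_iff_forall_level j hr S x y).1 h2 α,
      fun _ => ⟨β, hα₀.trans_le hα, fun γ hγ _ => ?_⟩⟩⟩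
    simpa using hβ γ hγ
  · rintro ⟨α₀, h⟩
    -- The level relations get finer as `α` grows, so those from `α₀` on imply all of them.
    have h2 := (stepRel_iff_forall_level j hr S x y).2 fun α => by
      have h3 := (h _ (le_max_right α α₀)).1
      exact ⟨fun γ hγ => h3.1 γ (hγ.trans (le_max_left _ _)), h3.2.mono (le_max_left _ _)⟩
    refine ⟨?_, h2⟩
    obtain ⟨β, hβ⟩ := exists_forall_ge_of_meetsClosurePoints hr (meetsClosurePoints_Ioi hr hκ α₀)
      fun α hα => (h α (le_of_lt hα)).2
    exact ⟨β, fun γ hγ => by simp [hβ γ hγ]⟩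

end GenCantor

end Relations

/-! ### Nonreducibility when the difference of the index sets is stationary. -/

section Nonreduction

variable {κ : Cardinal.{u}}

namespace GenCantor

variable (j : Idx κ ⊕ Idx κ ≃ Idx κ)

/-- Add `D` to the first half of `x`. -/
def flip (D x : GenCantor κ) : GenCantor κ := join j (diff (fstHalf j x) D) (sndHalf j x)

theorem fstHalf_flip (D x : GenCantor κ) : fstHalf j (flip j D x) = diff (fstHalf j x) D :=
  fstHalf_join _ _ _

theorem sndHalf_flip (D x : GenCantor κ) : sndHalf j (flip j D x) = sndHalf j x :=
  sndHalf_join _ _ _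

theorem flip_flip (D x : GenCantor κ) : flip j D (flip j D x) = x := by
  rw [flip, fstHalf_flip, sndHalf_flip]
  have : diff (diff (fstHalf j x) D) D = fstHalf j x := by funext i; simp
  rw [this, join_halves]

theorem diff_flip (D D' x : GenCantor κ) :
    diff (fstHalf j (flip j D x)) (fstHalf j (flip j D' x)) = diff D D' := by
  rw [fstHalf_flip, fstHalf_flip, diff_comm (fstHalf j x) D]
  exact diff_diff_cancel _ _ _

theorem continuous_flip (hr : κ.IsRegular) (D : GenCantor κ) : Continuous (flip j D) := by
  refine continuous_of_locally_determined hr fun x i => ?_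
  obtain ⟨α, hα⟩ := Idx.exists_gt hr i
  refine ⟨α, fun y hy => ?_⟩
  obtain ⟨k, rfl⟩ := j.surjective i
  rcases k with k | k
  · rw [flip, flip, join_inl, join_inl, diff_apply, diff_apply, fstHalf, fstHalf, hy _ hα]
  · rw [flip, flip, join_inr, join_inr]
    exact hy _ hα

theorem Comeager.preimage_flip (hr : κ.IsRegular) {G : Set (GenCantor κ)} (hG : Comeager G)
    (D : GenCantor κ) : Comeager (flip j D ⁻¹' G) := by
  let e : GenCantor κ ≃ₜ GenCantor κ :=
    { toFun := flip j D
      invFun := flip j D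
      left_inv := flip_flip j D
      right_inv := flip_flip j D
      continuous_toFun := continuous_flip j hr D
      continuous_invFun := continuous_flip j hr D }
  obtain ⟨U, hU, hUG⟩ := hG
  refine ⟨fun i => e ⁻¹' U i, fun i => ⟨(hU i).1.preimage e.continuous,
    (hU i).2.preimage e.isOpenMap⟩, ?_⟩
  rw [← Set.preimage_iInter]
  exact Set.preimage_mono hUG

/-- `D` is constant on a final segment. -/
def EvConst (D : GenCantor κ) : Prop := ∃ α b, ∀ γ, α ≤ γ → D γ = b

/-- Some point has all its flips by eventually constant functions in a given comeager set. -/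
theorem Comeager.exists_forall_flip_mem (hκ : ℵ₀ < κ) (hpow : κ ^< κ = κ)
    {G : Set (GenCantor κ)} (hG : Comeager G) : ∃ x, ∀ D, EvConst D → flip j D x ∈ G := by
  classical
  have hr := isRegular_of_powerlt_eq hκ hpow
  have hcard : #(Seg κ × ULift.{u} Bool) ≤ κ := by
    rw [mk_prod]
    simp only [Cardinal.lift_id]
    calc #(Seg κ) * #(ULift.{u} Bool) ≤ κ * κ := mul_le_mul' (mk_seg_le hκ hpow)
          ((by simp : #(ULift.{u} Bool) < ℵ₀).trans hκ).le
      _ = κ := mul_eq_self hκ.le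
  -- A segment and a final value determine an eventually constant function, so only `κ` comeager
  -- sets have to be met.
  let E : Seg κ × ULift.{u} Bool → GenCantor κ := fun p i =>
    if h : i < p.1.1 then p.1.2 ⟨i, h⟩ else p.2.down
  obtain ⟨x, hx⟩ := (comeager_iInter hκ hr hcard fun p => hG.preimage_flip j hr (E p)).nonempty hr
  refine ⟨x, fun D ⟨α, b, h⟩ => ?_⟩
  have h1 := Set.mem_iInter.1 hx (⟨α, fun i => D i.1⟩, ⟨b⟩)
  have h2 : E (⟨α, fun i => D i.1⟩, ⟨b⟩) = D := by
    funext i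
    by_cases hi : i < α
    · exact dif_pos hi
    · exact (dif_neg hi).trans (h i (not_lt.1 hi)).symm
  rwa [h2] at h1

theorem exists_agreeBelow_flip (hr : κ.IsRegular) (α : Idx κ) : ∃ δ, ∀ D D' x : GenCantor κ,
    AgreeBelow δ D D' → AgreeBelow α (flip j D x) (flip j D' x) := by
  obtain ⟨δ, hδ⟩ := exists_forall_lt_of_mk_lt hr
    (fun i : Set.Iio α => Sum.elim id id (j.symm i.1)) (Idx.mk_Iio_lt α)
  refine ⟨δ, fun D D' x h i hi => ?_⟩
  have h1 := hδ ⟨i, hi⟩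
  obtain ⟨k, rfl⟩ := j.surjective i
  rcases k with k | k
  · rw [flip, flip, join_inl, join_inl, diff_apply, diff_apply, h k]
    simp only [Equiv.symm_apply_apply] at h1
    exact h1
  · rw [flip, flip, join_inr, join_inr]

/-- The `0`-`1` function which starts with `0` and switches at the points of a (decreasing) list. -/
noncomputable def stepFn : List (Idx κ) → GenCantor κ
  | [] => const false
  | a :: l => fun i => if i < a then stepFn l i else (l.length + 1).bodd

theorem stepFn_eventually (hr : κ.IsRegular) (l : List (Idx κ)) :
    ∃ β, ∀ γ, β ≤ γ → stepFn l γ = l.length.bodd := by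
  cases l with
  | nil =>
    obtain ⟨o, -⟩ := Idx.exists_isLeast hr
    exact ⟨o, fun _ _ => by simp [stepFn, const]⟩
  | cons a l => exact ⟨a, fun γ hγ => if_neg (not_lt.2 hγ)⟩

theorem evConstBelow_stepFn (l : List (Idx κ)) {α : Idx κ} (hα : ∃ β, β < α) :
    EvConstBelow (stepFn l) α := by
  induction l with
  | nil =>
    obtain ⟨β, hβ⟩ := hα
    exact ⟨β, hβ, false, fun _ _ _ => rfl⟩
  | cons a l ih =>
    rcases le_or_gt α a with h | h
    · exact ih.congr fun γ hγ => if_pos (hγ.trans_le h)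
    · exact ⟨a, h, _, fun γ hγ _ => if_neg (not_lt.2 hγ)⟩

theorem evConstBelow_const (b : Bool) {α : Idx κ} (hα : ∃ β, β < α) :
    EvConstBelow (const b) α := by
  obtain ⟨β, hβ⟩ := hα
  exact ⟨β, hβ, b, fun _ _ _ => rfl⟩

theorem diff_const_false (x : GenCantor κ) : diff x (const false) = x := by
  funext i; simp [const]

/-- A function that is eventually constant below all points of a stationary set is eventually
constant. -/
theorem evConst_of_meetsClosurePoints (hr : κ.IsRegular) {S : Set (Idx κ)}
    (hS : MeetsClosurePoints S) {D : GenCantor κ}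
    (h : ∀ α ∈ S, (∃ β, β < α) → EvConstBelow D α) : EvConst D := by
  classical
  have hg : ∀ α, ∃ β, α ∈ S → (∃ β, β < α) → β < α ∧ ∃ b, ∀ γ, β ≤ γ → γ < α → D γ = b :=
    fun α => by
    by_cases h' : α ∈ S ∧ ∃ β, β < α
    · obtain ⟨β, hβ⟩ := h α h'.1 h'.2
      exact ⟨β, fun _ _ => hβ⟩
    · exact ⟨α, fun h1 h2 => absurd ⟨h1, h2⟩ h'⟩
  choose g hg using hg
  obtain ⟨β, hβ⟩ := hS.fodor hr g fun α hα hne => (hg α hα hne).1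
  refine ⟨β, D β, fun γ hγ => ?_⟩
  obtain ⟨α, ⟨hα1, hα2⟩, hα3⟩ := hβ.exists_gt γ
  obtain ⟨b, hb⟩ := (hg α hα1 ⟨γ, hα3⟩).2
  rw [hb γ (hα2.trans_le hγ) hα3, hb β hα2.le (hγ.trans_lt hα3)]

/-- Given bounds `next l` for finite sequences and a point `α` of countable cofinality closed under
`next`, there is a function with jumps accumulating only at `α`, which is approximated below `α` by
step functions with fast growing jumps. -/
theorem exists_fast_step {α : Idx κ} (hα : CountablyApproached α) (next : List (Idx κ) → Idx κ)
    (hnext : ∀ a l, a < next (a :: l))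
    (hcl : ∀ l : List (Idx κ), (∀ a ∈ l, a < α) → next l < α) :
    ∃ (D : GenCantor κ) (a : ℕ → Idx κ) (L : ℕ → List (Idx κ)),
      (∀ n, (L n).length = n) ∧ (∀ n, L (n + 1) = a n :: L n) ∧ (∀ n, next (L n) ≤ a n) ∧
      (∀ n, a n < α) ∧ (∀ β < α, ∃ n, β < a n) ∧ (∀ n, AgreeBelow (a n) (stepFn (L n)) D) ∧
      ∀ γ, α ≤ γ → D γ = false := by
  classical
  obtain ⟨c, hcα, hcof⟩ := hα
  -- The term `c n` makes the jumps cofinal in `α`; the term `next l` makes them grow fast.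
  let L : ℕ → List (Idx κ) := fun n => Nat.rec [] (fun n l => max (c n) (next l) :: l) n
  let a : ℕ → Idx κ := fun n => max (c n) (next (L n))
  have hL : ∀ n, L (n + 1) = a n :: L n := fun n => rfl
  have hlen : ∀ n, (L n).length = n := fun n => by
    induction n with
    | zero => rfl
    | succ n ih => rw [hL, List.length_cons, ih]
  have hLα : ∀ n, ∀ b ∈ L n, b < α := fun n => by
    induction n with
    | zero => intro b hb; exact absurd hb (by simp [L])
    | succ n ih =>
      intro b hb
      rw [hL, List.mem_cons] at hb
      rcases hb with rfl | hb
      · exact max_lt (hcα n) (hcl _ ih)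
      · exact ih b hb
  have haα : ∀ n, a n < α := fun n => max_lt (hcα n) (hcl _ (hLα n))
  have hmono : StrictMono a := strictMono_nat_of_lt_succ fun n => by
    calc a n < next (L (n + 1)) := by rw [hL]; exact hnext _ _
      _ ≤ a (n + 1) := le_max_right _ _
  have hcofa : ∀ β < α, ∃ n, β < a n := fun β hβ => by
    obtain ⟨n, hn⟩ := hcof β hβ
    exact ⟨n + 1, (hn.trans (le_max_left _ _)).trans_lt (hmono n.lt_succ_self)⟩
  -- `Nat.find` counts the jumps `a m ≤ i`, so below `α` the value of `D` is the parity of the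
  -- number of jumps made so far.
  let D : GenCantor κ := fun i => if h : i < α then (Nat.find (hcofa i h)).bodd else false
  refine ⟨D, a, L, hlen, hL, fun n => le_max_right _ _, haα, hcofa, fun n => ?_,
    fun γ hγ => dif_neg (not_lt.2 hγ)⟩
  have hD : ∀ i (h : i < α), D i = (Nat.find (hcofa i h)).bodd := fun i h => dif_pos h
  induction n with
  | zero =>
    intro i hi
    rw [hD i (hi.trans (haα 0)), (Nat.find_eq_zero _).2 hi]
    rfl
  | succ n ih =>
    intro i hi
    rw [hL]
    by_cases h : i < a n
    · rw [ih i h]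
      exact (if_pos h).symm
    · have hi' := hi.trans (haα _)
      have : Nat.find (hcofa i hi') = n + 1 := by
        rw [Nat.find_eq_iff]
        exact ⟨hi, fun m hm h' => h (h'.trans_le (hmono.monotone (Nat.lt_succ_iff.1 hm)))⟩
      rw [hD i hi', this]
      exact ((if_neg h).trans (by rw [hlen])).symm

/-- The main non-reducibility result. -/
theorem not_stepRel_reducible (hκ : ℵ₀ < κ) (hpow : κ ^< κ = κ) {S T : Set (Idx κ)}
    (hS : ∀ α ∈ S, CountablyApproached α) (hST : MeetsClosurePoints (S \ T)) :
    ¬ BorelReducible (stepRel j S) (stepRel j T) := by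
  classical
  rintro ⟨f, hf, hred⟩
  have hr := isRegular_of_powerlt_eq hκ hpow
  obtain ⟨o, ho⟩ := Idx.exists_isLeast hr
  obtain ⟨G, hG, hcont⟩ := exists_comeager_continuous hκ hr hf
  obtain ⟨x, hx⟩ := hG.exists_forall_flip_mem j hκ hpow
  let g : GenCantor κ → GenCantor κ := fun D => f (flip j D x)
  have hgcont : ∀ D, EvConst D → ∀ i, ∃ δ, ∀ D', EvConst D' → AgreeBelow δ D D' →
      g D' i = g D i := fun D hD i => by
    obtain ⟨α, hα⟩ := hcont _ (hx D hD) i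
    obtain ⟨δ, hδ⟩ := exists_agreeBelow_flip j hr α
    exact ⟨δ, fun D' hD' h => hα _ (hx D' hD') (hδ D D' x h)⟩
  have hgred : ∀ D D' : GenCantor κ, ((∃ β, ∀ γ, β ≤ γ → diff D D' γ = false) ∧
      JumpsAccumulateIn S (diff D D')) ↔ stepRel j T (g D) (g D') := fun D D' => by
    rw [← hred, stepRel, diff_flip, sndHalf_flip, sndHalf_flip]
    simp
  let h : GenCantor κ → GenCantor κ := fun D => diff (fstHalf j (g D)) (fstHalf j (g (const false)))
  have hconst : ∀ b, EvConst (const b : GenCantor κ) := fun b => ⟨o, b, fun _ _ => rfl⟩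
  let seg : Idx κ → GenCantor κ := fun δ i => decide (i < δ)
  have hseg : ∀ δ, EvConst (seg δ) := fun δ =>
    ⟨δ, false, fun γ hγ => decide_eq_false (not_lt.2 hγ)⟩
  have hsegT : ∀ δ, stepRel j T (g (seg δ)) (g (const false)) := fun δ => by
    rw [← hgred, diff_const_false]
    refine ⟨⟨δ, fun γ hγ => decide_eq_false (not_lt.2 hγ)⟩, fun α _ ⟨β, hβ⟩ => ?_⟩
    rcases le_or_gt α δ with h | h
    · exact ⟨β, hβ, true, fun γ _ hγ => decide_eq_true (hγ.trans_le h)⟩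
    · exact ⟨δ, h, false, fun γ hγ _ => decide_eq_false (not_lt.2 hγ)⟩
  -- The constant `1` is the limit of the functions `seg δ`, all of which are `E_S`-trivial. Hence
  -- coordinatewise closed conditions pass to its image, though boundedness need not.
  have hlim : ∀ i, ∃ δ, ∀ δ', δ ≤ δ' → g (seg δ') i = g (const true) i := fun i => by
    obtain ⟨δ, hδ⟩ := hgcont _ (hconst true) i
    exact ⟨δ, fun δ' h => hδ _ (hseg δ') fun k hk => decide_eq_true (hk.trans_le h)⟩
  have hsnd : sndHalf j (g (const true)) = sndHalf j (g (const false)) := by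
    funext i
    obtain ⟨δ, hδ⟩ := hlim (j (Sum.inr i))
    exact (hδ δ le_rfl).symm.trans (congrFun (hsegT δ).2.2 i)
  have hjump : JumpsAccumulateIn T (h (const true)) := fun α hα hne => by
    choose δ hδ using fun i => hlim (j (Sum.inl i))
    obtain ⟨ε, hε⟩ := exists_forall_lt_of_mk_lt hr (fun i : Set.Iio α => δ i.1) (Idx.mk_Iio_lt α)
    refine ((hsegT ε).2.1 α hα hne).congr fun i hi => ?_
    have := hδ i ε (hε ⟨i, hi⟩).le
    simp only [h, diff_apply, fstHalf, this]
  -- Fodor's lemma on `S \ T` makes this function eventually constant. The value `0` would make the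
  -- constants `0` and `1` equivalent, although they differ everywhere.
  have hone : ∃ β, ∀ γ, β ≤ γ → h (const true) γ = true := by
    obtain ⟨β, b, hb⟩ := evConst_of_meetsClosurePoints hr hST fun α hα => hjump α hα.2
    cases b with
    | true => exact ⟨β, hb⟩
    | false =>
      obtain ⟨⟨γ, hγ⟩, -⟩ := (hgred _ _).2 ⟨⟨β, hb⟩, hjump, hsnd⟩
      exact absurd (hγ γ le_rfl) (by simp [const])
  -- A step function is `E_S`-equivalent to the constant given by the parity of its number of jumps.
  have hstep : ∀ l, ∃ β, ∀ γ, β ≤ γ → h (stepFn l) γ = l.length.bodd := fun l => by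
    obtain ⟨β, hβ⟩ := stepFn_eventually hr l
    cases hb : l.length.bodd with
    | false =>
      refine ((hgred (stepFn l) (const false)).1 ?_).1
      rw [diff_const_false]
      exact ⟨⟨β, fun γ hγ => (hβ γ hγ).trans hb⟩, fun α _ hne => evConstBelow_stepFn l hne⟩
    | true =>
      have h1 : stepRel j T (g (stepFn l)) (g (const true)) := (hgred _ _).1
        ⟨⟨β, fun γ hγ => by rw [diff_apply, hβ γ hγ, hb]; rfl⟩,
          fun α _ hne => (evConstBelow_stepFn l hne).xor (evConstBelow_const true hne)⟩
      obtain ⟨γ₁, hγ₁⟩ := h1.1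
      obtain ⟨γ₂, hγ₂⟩ := hone
      refine ⟨max γ₁ γ₂, fun γ hγ => ?_⟩
      have h2 := hγ₂ γ ((le_max_right _ _).trans hγ)
      simp only [h] at h2 ⊢
      rw [← diff_diff_cancel _ (fstHalf j (g (const true))), diff_apply,
        hγ₁ γ ((le_max_left _ _).trans hγ), h2]
      rfl
  -- The parity is witnessed at a coordinate `ξ` at or above the last jump, and by continuity it
  -- survives every change of the input from `δ` on. The bound `l.headD o ≤ ξ` later makes the
  -- witnesses cofinal in `α`.
  have happrox : ∀ l : List (Idx κ), ∃ ξ δ, l.headD o ≤ ξ ∧ ∀ D, EvConst D →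
      AgreeBelow δ (stepFn l) D → h D ξ = l.length.bodd := fun l => by
    obtain ⟨β, hβ⟩ := hstep l
    obtain ⟨ε, b, hb⟩ : EvConst (stepFn l) := by
      obtain ⟨ε, hε⟩ := stepFn_eventually hr l
      exact ⟨ε, _, hε⟩
    obtain ⟨δ, hδ⟩ := hgcont _ ⟨ε, b, hb⟩ (j (Sum.inl (max β (l.headD o))))
    refine ⟨max β (l.headD o), δ, le_max_right _ _, fun D hD hag => ?_⟩
    rw [← hβ _ (le_max_left β (l.headD o))]
    simp only [h, diff_apply, fstHalf, hδ D hD hag]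
  choose ξ δ hξ hδ using happrox
  have hnext : ∀ l, ∃ η, max (ξ l) (δ l) < η := fun l => Idx.exists_gt hr _
  choose next hnext using hnext
  obtain ⟨α, hα, hne, hcl⟩ := hST.exists_list hr hκ next
  obtain ⟨D, a, L, hlen, hL, hna, haα, hcof, hagree, hzero⟩ :=
    exists_fast_step (hS α hα.1) next (fun a l => by
      have := hξ (a :: l)
      exact (this.trans (le_max_left _ _)).trans_lt (hnext (a :: l))) hcl
  have hDT : stepRel j T (g D) (g (const false)) := by
    rw [← hgred, diff_const_false]
    -- The jumps of `D` accumulate only at `α`, which is allowed because `α ∈ S`; so `D` is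
    -- `E_S`-trivial.
    refine ⟨⟨α, hzero⟩, fun γ hγ hγne => ?_⟩
    rcases lt_trichotomy γ α with h | rfl | h
    · obtain ⟨n, hn⟩ := hcof γ h
      exact (evConstBelow_stepFn (L n) hγne).congr fun i hi => hagree n i (hi.trans hn)
    · exact absurd hα.1 hγ
    · exact ⟨α, h, false, fun i hi _ => hzero i hi⟩
  obtain ⟨β, hβ, b, hb⟩ := hDT.2.1 α hα.2 hne
  have hval : ∀ n, h D (ξ (L n)) = n.bodd := fun n => by
    have := hδ (L n) D ⟨α, false, hzero⟩ ((hagree n).mono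
      (((le_max_right _ _).trans (hnext (L n)).le).trans (hna n)))
    rwa [hlen] at this
  have hξα : ∀ n, ξ (L n) < α := fun n =>
    ((le_max_left _ _).trans_lt ((hnext (L n)).trans_le (hna n))).trans (haα n)
  -- Two consecutive witnesses beyond `β` carry opposite parities, against eventual constancy below
  -- `α ∉ T`.
  obtain ⟨n, hn⟩ := hcof β hβ
  have hlarge : ∀ m, β < a m → h D (ξ (L (m + 1))) = b := fun m hm =>
    hb _ (by
      have := hξ (L (m + 1))
      rw [hL] at this ⊢
      exact hm.le.trans this) (hξα _)
  have han : a n < a (n + 1) := by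
    have h1 := hξ (L (n + 1))
    rw [hL] at h1
    have h2 := (le_max_left _ _).trans_lt ((hnext (L (n + 1))).trans_le (hna (n + 1)))
    rw [hL] at h2
    exact lt_of_le_of_lt h1 h2
  have e1 := hlarge n hn
  have e2 := hlarge (n + 1) (hn.trans han)
  rw [hval] at e1 e2
  rw [Nat.bodd_succ, e1] at e2
  cases b <;> simp at e2

end GenCantor

end Nonreduction

/-! ### A lexicographic chain of `2^κ` index sets. -/

section Chain

variable {κ : Cardinal.{u}}

namespace GenCantor

/-- `x` is lexicographically smaller than `y`. -/
def LexLT (x y : GenCantor κ) : Prop := ∃ δ, AgreeBelow δ x y ∧ x δ = false ∧ y δ = true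

theorem LexLT.trichotomy (x y : GenCantor κ) : LexLT x y ∨ x = y ∨ LexLT y x := by
  by_cases h : x = y
  · exact Or.inr (Or.inl h)
  · have hne : ∃ i, x i ≠ y i := by
      by_contra! h'
      exact h (funext h')
    obtain ⟨δ, hδ, hmin⟩ := WellFounded.has_min (wellFounded_lt (α := Idx κ)) {i | x i ≠ y i} hne
    have hag : AgreeBelow δ x y := fun i hi => by
      by_contra h'
      exact hmin i (Ne.symm h') hi
    have hδ' : x δ ≠ y δ := hδ
    cases hx : x δ <;> cases hy : y δ
    · exact absurd (hx.trans hy.symm) hδ'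
    · exact Or.inl ⟨δ, hag, hx, hy⟩
    · exact Or.inr (Or.inr ⟨δ, hag.symm, hy, hx⟩)
    · exact absurd (hx.trans hy.symm) hδ'

/-- The initial segments `p` that are lexicographically smaller than `x`. -/
def lexCut (x : GenCantor κ) : Set (Seg κ) :=
  {p | ∃ δ, ∃ h : δ < p.1, (∀ β (hβ : β < δ), p.2 ⟨β, hβ.trans h⟩ = x β) ∧
    p.2 ⟨δ, h⟩ = false ∧ x δ = true}

theorem lexCut_subset {x y : GenCantor κ} (h : LexLT x y) : lexCut x ⊆ lexCut y := by
  obtain ⟨ε, hε, hx, hy⟩ := h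
  rintro p ⟨δ, hδ, h1, h2, h3⟩
  rcases lt_trichotomy δ ε with h | rfl | h
  · exact ⟨δ, hδ, fun β hβ => (h1 β hβ).trans (hε β (hβ.trans h)).symm, h2, (hε δ h).trans h3⟩
  · rw [hx] at h3; exact absurd h3 (by simp)
  · exact ⟨ε, h.trans hδ, fun β hβ => (h1 β (hβ.trans h)).trans (hε β hβ).symm,
      (h1 ε h).trans hx, hy⟩

/-- The separating segment is one of `x` that reaches past the splitting coordinate. With
`lexCut_subset` this embeds the lexicographic order on `2^κ` into the subsets of `Seg κ` ordered by
inclusion. -/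
theorem exists_mem_lexCut_notMem (hr : κ.IsRegular) {x y : GenCantor κ} (h : LexLT x y) :
    ∃ p, p ∈ lexCut y ∧ p ∉ lexCut x := by
  obtain ⟨ε, hε, hx, hy⟩ := h
  obtain ⟨α, hα⟩ := Idx.exists_gt hr ε
  refine ⟨⟨α, fun β => x β.1⟩, ⟨ε, hα, fun β hβ => (hε β hβ).symm, hx, hy⟩, ?_⟩
  rintro ⟨δ, hδ, -, h2, h3⟩
  exact absurd (h2.symm.trans h3) (by simp)

theorem mk_genCantor : #(GenCantor κ) = 2 ^ κ := by
  have : #(κ.ord.ToType → Bool) = 2 ^ κ := by simp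
  exact this

end GenCantor

theorem exists_equiv_sum (hκ : ℵ₀ < κ) : Nonempty (Idx κ ⊕ Idx κ ≃ Idx κ) := by
  rw [← Cardinal.eq, mk_sum]
  simp only [Cardinal.lift_id, mk_ord_toType]
  exact add_eq_self hκ.le

end Chain

open GenCantor

theorem corollary18 (κ : Cardinal.{u}) (hκ : ℵ₀ < κ) (hpow : κ ^< κ = κ) :
    ∃ 𝓕 : Set (GenCantor κ → GenCantor κ → Prop),
      #𝓕 = 2 ^ κ ∧
      (∀ E ∈ 𝓕, IsBorelEquivRel E ∧
        StrictlyBorelReducible (idRel κ) E ∧ StrictlyBorelReducible E (E₀ κ)) ∧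
      IsLinearOrder 𝓕 (fun E F => BorelReducible E.1 F.1) := by
  have hr := isRegular_of_powerlt_eq hκ hpow
  obtain ⟨j⟩ := exists_equiv_sum hκ
  obtain ⟨P, hP, hPc, hPd⟩ := exists_disjoint_meetsClosurePoints hr hκ
  -- Two spare indices: `some none` lies in every index set of the chain, keeping it strictly above
  -- `id`, and `none` lies in no such set, keeping it strictly below `E₀`.
  have hcard : #(Option (Option (Seg κ))) ≤ #(Idx κ) := by
    rw [mk_option, mk_option, mk_ord_toType]
    have h1 : (1 : Cardinal) ≤ κ := one_lt_aleph0.le.trans hκ.le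
    exact add_le_of_le hκ.le (add_le_of_le hκ.le (mk_seg_le hκ hpow) h1) h1
  obtain ⟨e⟩ := hcard
  let U : Set (Option (Option (Seg κ))) → Set (Idx κ) := fun A => ⋃ a ∈ A, P (e a)
  have hUmono : ∀ {A B}, A ⊆ B → U A ⊆ U B := fun h => Set.biUnion_subset_biUnion_left h
  have hUc : ∀ A, ∀ α ∈ U A, CountablyApproached α := fun A α h => by
    obtain ⟨a, -, h'⟩ := Set.mem_iUnion₂.1 h
    exact hPc _ _ h'
  have hle : ∀ {A B}, A ⊆ B → BorelReducible (stepRel j (U A)) (stepRel j (U B)) := fun h =>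
    stepRel_reducible_of_subset j hκ hpow (hUmono h)
  have hnle : ∀ {A B} a, a ∈ A → a ∉ B →
      ¬ BorelReducible (stepRel j (U A)) (stepRel j (U B)) := fun {A B} a hA hB => by
    refine not_stepRel_reducible j hκ hpow (hUc A) ((hP (e a)).mono fun α hα => ⟨?_, fun h => ?_⟩)
    · exact Set.mem_iUnion₂.2 ⟨a, hA, hα⟩
    · obtain ⟨b, hb, hα'⟩ := Set.mem_iUnion₂.1 h
      rw [e.injective (hPd _ _ _ hα hα')] at hA hB
      exact hB hb
  let A : GenCantor κ → Set (Option (Option (Seg κ))) := fun x =>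
    insert (some none) ((fun p => some (some p)) '' lexCut x)
  let R : GenCantor κ → GenCantor κ → GenCantor κ → Prop := fun x => stepRel j (U (A x))
  have hRle : ∀ {x y}, LexLT x y → BorelReducible (R x) (R y) := fun h =>
    hle (Set.insert_subset_insert (Set.image_mono (lexCut_subset h)))
  have hRnle : ∀ {x y}, LexLT x y → ¬ BorelReducible (R y) (R x) := fun {x y} h => by
    obtain ⟨p, hp, hp'⟩ := exists_mem_lexCut_notMem hr h
    exact hnle (some (some p)) (by simp [A, hp]) (by simp [A, hp'])
  have hinj : Function.Injective R := fun x y h => by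
    rcases LexLT.trichotomy x y with h' | h' | h'
    · exact absurd (h ▸ BorelReducible.refl (R x)) (hRnle h')
    · exact h'
    · exact absurd (h ▸ BorelReducible.refl (R x)) (hRnle h')
  refine ⟨Set.range R, ?_, ?_, ?_⟩
  · rw [mk_range_eq R hinj, mk_genCantor]
  · rintro _ ⟨x, rfl⟩
    refine ⟨isBorelEquivRel_stepRel j hκ hr _, ⟨idRel_reducible_stepRel j hr _, fun h => ?_⟩,
      ⟨stepRel_reducible_E₀ j hκ hpow _, fun h => ?_⟩⟩
    -- A reduction to `id` would give one to the relation of the empty index set.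
    · exact hnle (B := ∅) (some none) (Set.mem_insert _ _) (Set.notMem_empty _)
        (h.trans (idRel_reducible_stepRel j hr _))
    -- A reduction of `E₀` would give one of the relation of the full index set.
    · exact hnle (A := Set.univ) (B := A x) none trivial (by simp [A])
        ((stepRel_reducible_E₀ j hκ hpow _).trans h)
  · exact
    { refl := fun E => BorelReducible.refl _
      trans := fun _ _ _ => BorelReducible.trans
      antisymm := by
        rintro ⟨_, x, rfl⟩ ⟨_, y, rfl⟩ h h'
        rcases LexLT.trichotomy x y with hxy | rfl | hxy
        · exact absurd h' (hRnle hxy)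
        · rfl
        · exact absurd h (hRnle hxy)
      total := by
        rintro ⟨_, x, rfl⟩ ⟨_, y, rfl⟩
        rcases LexLT.trichotomy x y with hxy | rfl | hxy
        · exact Or.inl (hRle hxy)
        · exact Or.inl (BorelReducible.refl _)
        · exact Or.inr (hRle hxy) }
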